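/- Let $n$ be a natural number and let $B_n$ be the braid group on $n$ strings, i.e. the group generated by $\sigma_1,\dots,\sigma_{n-1}$ subject to the relations $\sigma_j\sigma_k=\sigma_k\sigma_j$ if $|j-k|>1$ and $\sigma_j\sigma_k\sigma_j=\sigma_k\sigma_j\sigma_k$ if $|j-k|=1$. For a simple graph $\Gamma$ (no loops, no multiple edges) with vertex set $X$ and edge set $E(\Gamma)$, let $\mathcal M(\Gamma)$ be its graph monoid (right-angled Artin monoid), given by the monoid presentation $$\mathcal M(\Gamma)=\langle X \mid xy=yx \text{ if } \{x,y\}\in E(\Gamma)\rangle^+ .$$ Let $\Omega$ be the simple graph whose vertex set is $$\Upsilon=\{\alpha\sigma_i^2\alpha^{-1} : \alpha\in B_n,\ 1\le i\le n-1\}\subseteq B_n ,$$ two distinct vertices $u,v$ being joined by an edge if and only if $uv=vu$ in $B_n$. Let $\nu\colon\mathcal M(\Omega)\to\mathbb Z[B_n]$ be the homomorphism from $\mathcal M(\Omega)$ to the multiplicative monoid of the integral group ring of $B_n$ defined by $\nu(u)=u-1$ for all $u\in\Upsilon$. Then $\nu$ is injective. -/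

import Mathlib

/-- The relators of Artin's presentation of the braid group on `n` strings; the index `i : Fin (n - 1)`
stands for the generator usually written `σ_{i+1}`. The first set expresses `σ_j σ_k = σ_k σ_j` for
`|j - k| > 1`, the second `σ_j σ_k σ_j = σ_k σ_j σ_k` for `|j - k| = 1`. -/
def braidRels (n : ℕ) : Set (FreeGroup (Fin (n - 1))) :=
  {r | ∃ j k : Fin (n - 1), 1 < |(j : ℤ) - (k : ℤ)| ∧
      r = (FreeGroup.of j * FreeGroup.of k) * (FreeGroup.of k * FreeGroup.of j)⁻¹} ∪
  {r | ∃ j k : Fin (n - 1), |(j : ℤ) - (k : ℤ)| = 1 ∧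
      r = (FreeGroup.of j * FreeGroup.of k * FreeGroup.of j) *
        (FreeGroup.of k * FreeGroup.of j * FreeGroup.of k)⁻¹}

/-- The braid group `B_n` on `n` strings. -/
abbrev BraidGroup (n : ℕ) : Type := PresentedGroup (braidRels n)

/-- The standard generators of `B_n`. -/
def braidGen (n : ℕ) (i : Fin (n - 1)) : BraidGroup n := PresentedGroup.of i

/-- The relations `x y = y x` for `{x, y}` an edge of the graph `Γ`. -/
inductive graphMonoidRels {X : Type*} (Γ : SimpleGraph X) : FreeMonoid X → FreeMonoid X → Prop
  | comm (x y : X) (h : Γ.Adj x y) :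
      graphMonoidRels Γ (FreeMonoid.of x * FreeMonoid.of y) (FreeMonoid.of y * FreeMonoid.of x)

/-- The graph monoid (right-angled Artin monoid, free partially commutative monoid) of `Γ`. -/
abbrev GraphMonoid {X : Type*} (Γ : SimpleGraph X) : Type _ := PresentedMonoid (graphMonoidRels Γ)

/-- The set of all `B_n`-conjugates of the squares of the standard generators. -/
def conjSquares (n : ℕ) : Set (BraidGroup n) :=
  {u | ∃ (α : BraidGroup n) (i : Fin (n - 1)), u = α * braidGen n i ^ 2 * α⁻¹}

/-- The graph with vertex set `conjSquares n`, in which two distinct vertices are joined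
if and only if they commute in `B_n`. -/
def commGraph (n : ℕ) : SimpleGraph (conjSquares n) where
  Adj u v := u ≠ v ∧ (u : BraidGroup n) * (v : BraidGroup n) = (v : BraidGroup n) * (u : BraidGroup n)
  symm := ⟨fun _ _ h => ⟨h.1.symm, h.2.symm⟩⟩
  loopless := ⟨fun _ h => h.1 rfl⟩

/-- The monoid homomorphism from the graph monoid of `commGraph n` to the multiplicative monoid of
the integral group ring of `B_n` sending each vertex `u` to `u - 1`. -/
noncomputable def nuHom (n : ℕ) : GraphMonoid (commGraph n) →* MonoidAlgebra ℤ (BraidGroup n) :=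
  PresentedMonoid.lift
    (fun u : conjSquares n => MonoidAlgebra.of ℤ (BraidGroup n) (u : BraidGroup n) - 1) (by
      rintro _ _ ⟨x, y, h⟩
      have hc : Commute (MonoidAlgebra.of ℤ (BraidGroup n) (x : BraidGroup n))
          (MonoidAlgebra.of ℤ (BraidGroup n) (y : BraidGroup n)) :=
        Commute.map (show Commute (x : BraidGroup n) (y : BraidGroup n) from h.2) _
      have hd := (hc.sub_left (Commute.one_left _)).sub_right (Commute.one_right _)
      simpa only [map_mul, FreeMonoid.lift_eval_of] using hd.eq)

/-!
Elements `a x` of a monoid with zero generate a copy of the graph monoid once they are left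
regular and not right invertible, and any two of them, for `x ≠ y`, either have no nonzero common
right multiple or belong to adjacent vertices and satisfy `a y ∣ a x * m → a y ∣ m`: then `a y`
divides a product of generators only if `y` can be moved to its front.

In a group ring, `v - 1` divides `P` exactly when the coefficients of `P` sum to zero over each
coset `⟨v⟩ g`. This gives the second alternative for `u - 1` and `v - 1` when `u` and `v` commute
and are independent. The first holds when the group acts on a set with a length function such
that every point is lengthened by all nontrivial powers of `u` or by all nontrivial powers of `v`: a
longest point coming from the support of a common multiple would be alone in its coset.

Two conjugates of squares of generators of the braid group each entangle a pair of strands. If the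
pairs share a strand, a conjugation makes it the last one; then both braids are loops of the last
strand, that is, conjugates of basis elements in a free group, and word length serves as the length
function. If the pairs are disjoint, a conjugation turns one braid into `σ₀²` and the other into a
loop of the last strand. By Artin's representation, `σ₀²` acts on the free group of loops, in a
suitable basis, by conjugating one basis element `z` by another, while the loop acts by left
multiplication. Either the loop does not involve `z`, and the two braids commute, or counting the
occurrences of `z` provides the length function.
-/

section GraphMonoid

lemma presentedMonoid_cons_induction {X : Type*} {rels : FreeMonoid X → FreeMonoid X → Prop}
    {p : PresentedMonoid rels → Prop} (one : p 1)
    (of_mul : ∀ x a, p a → p (PresentedMonoid.of rels x * a)) (a : PresentedMonoid rels) : p a := by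
  induction a using PresentedMonoid.inductionOn with | _ w
  induction w using FreeMonoid.inductionOn' with
  | one => exact one
  | of_mul x w ih => rw [map_mul]; exact of_mul x _ ih

/-- The right ideals generated by `a` and `b` meet trivially. (`a ∣ m` means `m ∈ a M`.) -/
def NoCommonMultiple {M : Type*} [MonoidWithZero M] (a b : M) : Prop :=
  ∀ m, a ∣ m → b ∣ m → m = 0

variable {X M : Type*} {Γ : SimpleGraph X} [MonoidWithZero M] [Nontrivial M]
  {f : GraphMonoid Γ →* M}

lemma map_ne_zero_and_exists_eq_of_mul
    (hreg : ∀ x, IsLeftRegular (f (PresentedMonoid.of _ x)))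
    (hunit : ∀ x, ¬ f (PresentedMonoid.of _ x) ∣ 1)
    (hpair : ∀ x y, x ≠ y →
      NoCommonMultiple (f (PresentedMonoid.of _ x)) (f (PresentedMonoid.of _ y)) ∨
      Γ.Adj x y ∧ ∀ m, f (PresentedMonoid.of _ y) ∣ f (PresentedMonoid.of _ x) * m →
        f (PresentedMonoid.of _ y) ∣ m)
    (y : X) (a : GraphMonoid Γ) :
    f a ≠ 0 ∧ (f (PresentedMonoid.of _ y) ∣ f a → ∃ b, a = PresentedMonoid.of _ y * b) := by
  induction a using presentedMonoid_cons_induction with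
  | one => rw [map_one]; exact ⟨one_ne_zero, fun h => absurd h (hunit y)⟩
  | of_mul x a ih =>
    obtain ⟨ha, hya⟩ := ih
    rw [map_mul]
    have hne : f (PresentedMonoid.of _ x) * f a ≠ 0 :=
      fun h => ha (hreg x (h.trans (mul_zero _).symm))
    refine ⟨hne, fun hdvd => ?_⟩
    obtain rfl | hxy := eq_or_ne x y
    · exact ⟨a, rfl⟩
    obtain hmeet | ⟨hadj, hcancel⟩ := hpair x y hxy
    · exact absurd (hmeet _ (dvd_mul_right _ _) hdvd) hne
    · obtain ⟨b, rfl⟩ := hya (hcancel _ hdvd)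
      refine ⟨PresentedMonoid.of _ x * b, ?_⟩
      have hcomm : PresentedMonoid.of (graphMonoidRels Γ) x * PresentedMonoid.of _ y =
          PresentedMonoid.of _ y * PresentedMonoid.of _ x :=
        PresentedMonoid.mk_eq_mk_of_rel (.comm x y hadj)
      rw [← mul_assoc, hcomm, mul_assoc]

theorem graphMonoidHom_injective
    (hreg : ∀ x, IsLeftRegular (f (PresentedMonoid.of _ x)))
    (hunit : ∀ x, ¬ f (PresentedMonoid.of _ x) ∣ 1)
    (hpair : ∀ x y, x ≠ y →
      NoCommonMultiple (f (PresentedMonoid.of _ x)) (f (PresentedMonoid.of _ y)) ∨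
      Γ.Adj x y ∧ ∀ m, f (PresentedMonoid.of _ y) ∣ f (PresentedMonoid.of _ x) * m →
        f (PresentedMonoid.of _ y) ∣ m) :
    Function.Injective f := by
  intro a
  induction a using presentedMonoid_cons_induction with
  | one =>
    intro b hb
    induction b using presentedMonoid_cons_induction with
    | one => rfl
    | of_mul y b _ =>
      rw [map_one, map_mul] at hb
      exact absurd ⟨_, hb⟩ (hunit y)
  | of_mul x a ih =>
    intro b hb
    rw [map_mul] at hb
    obtain ⟨c, rfl⟩ := (map_ne_zero_and_exists_eq_of_mul hreg hunit hpair x b).2 ⟨_, hb.symm⟩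
    rw [map_mul] at hb
    rw [ih (hreg x hb)]

end GraphMonoid

section GroupRing

lemma finsupp_eq_zero_of_invariant {X M : Type*} [Zero M] {f : X →₀ M} {U : X → X}
    (hf : ∀ x, f (U x) = f x) (hU : ∀ x, Function.Injective fun k : ℕ => U^[k] x) : f = 0 := by
  ext x
  have hconst : ∀ k : ℕ, f (U^[k] x) = f x := fun k => by
    induction k with
    | zero => rfl
    | succ k ih => rw [Function.iterate_succ_apply', hf, ih]
  by_contra hx
  refine Set.infinite_range_of_injective (hU x) (f.support.finite_toSet.subset ?_)
  rintro _ ⟨k, rfl⟩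
  simpa [hconst k] using hx

variable {R G : Type*} [Ring R] [Group G] {u v : G} {P : MonoidAlgebra R G}

variable (R) in
/-- The element `g - 1` of the group ring `R[G]`. -/
noncomputable def subOne (g : G) : MonoidAlgebra R G := MonoidAlgebra.of R G g - 1

lemma subOne_mul_eq_zero_iff : subOne R u * P = 0 ↔ ∀ g, P.coeff (u * g) = P.coeff g := by
  have hcoeff : ∀ g, (subOne R u * P).coeff (u * g) = P.coeff g - P.coeff (u * g) := fun g => by
    simp [subOne, sub_mul]
  constructor
  · intro h g
    exact (sub_eq_zero.mp ((hcoeff g).symm.trans (by simp [h]))).symm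
  · intro h
    ext g
    have := hcoeff (u⁻¹ * g)
    rwa [h, sub_self, mul_inv_cancel_left] at this

lemma isLeftRegular_subOne (hu : ¬ IsOfFinOrder u) : IsLeftRegular (subOne R u) := by
  refine isLeftRegular_iff_right_eq_zero_of_mul.mpr fun P hP => ?_
  rw [← MonoidAlgebra.coeff_eq_zero]
  refine finsupp_eq_zero_of_invariant (subOne_mul_eq_zero_iff.mp hP) fun g k l hkl => ?_
  simp only [mul_left_iterate] at hkl
  exact injective_pow_iff_not_isOfFinOrder.mpr hu (mul_right_cancel hkl)

/-- The coset `⟨v⟩ g`, as an element of the quotient by left multiplication by powers of `v`. -/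
def zpowersCoset (v g : G) : Quotient (QuotientGroup.rightRel (Subgroup.zpowers v)) :=
  Quotient.mk _ g

lemma zpowersCoset_eq_iff {g h : G} :
    zpowersCoset v g = zpowersCoset v h ↔ ∃ k : ℤ, v ^ k * g = h := by
  rw [zpowersCoset, zpowersCoset, Quotient.eq]
  simp only [QuotientGroup.rightRel_apply, Subgroup.mem_zpowers_iff, eq_mul_inv_iff_mul_eq]

lemma mapDomain_of_mul {Y : Type*} (m : G → Y) (u : G) (P : MonoidAlgebra R G) :
    (MonoidAlgebra.of R G u * P).mapDomain m = P.mapDomain (m ∘ (u * ·)) := by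
  induction P using MonoidAlgebra.induction_linear with
  | zero => simp
  | add P Q hP hQ => simp only [mul_add, MonoidAlgebra.mapDomain_add, hP, hQ]
  | single g c => simp

lemma mapDomain_subOne_mul_add {Y : Type*} (m : G → Y) (u : G) (P : MonoidAlgebra R G) :
    (subOne R u * P).mapDomain m + P.mapDomain m = P.mapDomain (m ∘ (u * ·)) := by
  rw [← mapDomain_of_mul, ← MonoidAlgebra.mapDomain_add, subOne, sub_one_mul, sub_add_cancel]

lemma subOne_dvd_subOne_zpow (v : G) (k : ℤ) : subOne R v ∣ subOne R (v ^ k) := by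
  have hadd : ∀ g h : G, subOne R (g * h) = subOne R g * MonoidAlgebra.of R G h + subOne R h :=
    fun g h => by simp [subOne, sub_mul, MonoidAlgebra.single_mul_single]
  induction k using Int.induction_on with
  | zero => simp [subOne, MonoidAlgebra.one_def]
  | succ k ih => rw [add_comm, zpow_one_add, hadd]; exact dvd_add (dvd_mul_right _ _) ih
  | pred k ih =>
    have h := hadd v (v ^ (-(k : ℤ) - 1))
    rw [← zpow_one_add, add_sub_cancel] at h
    rw [← sub_eq_iff_eq_add'.mpr h]
    exact dvd_sub ih (dvd_mul_right _ _)

theorem subOne_dvd_iff : subOne R v ∣ P ↔ P.mapDomain (zpowersCoset v) = 0 := by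
  constructor
  · rintro ⟨Q, rfl⟩
    have hcoset : zpowersCoset v ∘ (v * ·) = zpowersCoset v :=
      funext fun g => zpowersCoset_eq_iff.mpr ⟨-1, by simp⟩
    simpa [hcoset] using mapDomain_subOne_mul_add (zpowersCoset v) v Q
  · intro hP
    have hrep : ∀ P : MonoidAlgebra R G,
        subOne R v ∣ P - (P.mapDomain (zpowersCoset v)).mapDomain Quotient.out := by
      intro P
      induction P using MonoidAlgebra.induction_linear with
      | zero => simp
      | add P Q hP hQ =>
        simpa only [MonoidAlgebra.mapDomain_add, add_sub_add_comm] using dvd_add hP hQ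
      | single g c =>
        obtain ⟨k, hk⟩ := zpowersCoset_eq_iff.mp (Quotient.out_eq (zpowersCoset v g))
        refine ((subOne_dvd_subOne_zpow v k).mul_right
          (MonoidAlgebra.single (zpowersCoset v g).out c)).trans (dvd_of_eq ?_)
        simp [subOne, sub_mul, MonoidAlgebra.single_mul_single, hk]
    simpa [hP] using hrep P

lemma not_subOne_dvd_one [Nontrivial R] (v : G) : ¬ subOne R v ∣ 1 := by
  rw [subOne_dvd_iff, MonoidAlgebra.one_def, MonoidAlgebra.mapDomain_single]
  simp

lemma coeff_eq_zero_of_subOne_dvd {g : G} (hP : subOne R u ∣ P)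
    (hiso : ∀ k : ℤ, u ^ k * g ≠ g → P.coeff (u ^ k * g) = 0) : P.coeff g = 0 := by
  classical
  have hsum := congrArg (fun Q => Q.coeff (zpowersCoset u g)) (subOne_dvd_iff.mp hP)
  simp only [MonoidAlgebra.mapDomain, MonoidAlgebra.coeff_zero, Finsupp.coe_zero, Pi.zero_apply]
    at hsum
  rw [Finsupp.mapDomain_apply_eq_sum, Finset.sum_eq_single g] at hsum
  · exact hsum
  · intro h hh hhg
    obtain ⟨k, rfl⟩ := zpowersCoset_eq_iff.mp (Finset.mem_filter.mp hh).2.symm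
    exact hiso k hhg
  · intro hg
    simpa using hg

theorem subOne_dvd_of_dvd_subOne_mul (huv : Commute u v)
    (hind : ∀ a b : ℤ, u ^ a = v ^ b → a = 0) (h : subOne R v ∣ subOne R u * P) :
    subOne R v ∣ P := by
  have hshift : ∀ g h, zpowersCoset v (u * g) = zpowersCoset v (u * h) ↔
      zpowersCoset v g = zpowersCoset v h := fun g h => by
    simp only [zpowersCoset_eq_iff, ← mul_assoc, ← (huv.zpow_right _).eq]
    simp only [mul_assoc, mul_right_inj]
  let U : Quotient (QuotientGroup.rightRel (Subgroup.zpowers v)) →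
      Quotient (QuotientGroup.rightRel (Subgroup.zpowers v)) :=
    Quotient.map (u * ·) fun g h hgh => Quotient.exact ((hshift g h).mpr (Quotient.sound hgh))
  have hU : U ∘ zpowersCoset v = zpowersCoset v ∘ (u * ·) := rfl
  have hUinj : Function.Injective U :=
    Quotient.ind₂ fun g h hgh => (hshift g h).mp hgh
  have hiter : ∀ (k : ℕ) g, U^[k] (zpowersCoset v g) = zpowersCoset v (u ^ k * g) := fun k g => by
    induction k with
    | zero => simp
    | succ k ih => rw [Function.iterate_succ_apply', ih, pow_succ', mul_assoc]; rfl
  have hfix : (P.mapDomain (zpowersCoset v)).mapDomain U = P.mapDomain (zpowersCoset v) := by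
    have hadd := mapDomain_subOne_mul_add (zpowersCoset v) u P
    rw [subOne_dvd_iff.mp h, zero_add, ← hU] at hadd
    conv_rhs => rw [hadd]
    ext
    simp only [MonoidAlgebra.mapDomain, Finsupp.mapDomain_comp]
  rw [subOne_dvd_iff, ← MonoidAlgebra.coeff_eq_zero]
  refine finsupp_eq_zero_of_invariant (U := U) (fun x => ?_) (Quotient.ind fun g k l hkl => ?_)
  · conv_lhs => rw [← hfix]
    exact Finsupp.mapDomain_apply hUinj _ _
  · obtain ⟨b, hb⟩ := zpowersCoset_eq_iff.mp ((hiter k g).symm.trans (hkl.trans (hiter l g)))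
    rw [← mul_assoc, mul_left_inj, ← eq_mul_inv_iff_mul_eq, ← zpow_natCast, ← zpow_natCast,
      ← zpow_sub] at hb
    have := hind _ _ hb.symm
    omega

/-- The ping-pong alternative: each point is lengthened either by all nontrivial powers of `a` or by
all nontrivial powers of `b`. -/
def IsPingPongLength {Y : Type*} (ℓ : Y → ℕ) (a b : Equiv.Perm Y) : Prop :=
  ∀ y, (∀ k : ℤ, k ≠ 0 → ℓ y < ℓ ((a ^ k) y)) ∨ (∀ k : ℤ, k ≠ 0 → ℓ y < ℓ ((b ^ k) y))

lemma semiconj_perm_zpow {Y Ω : Type*} {ι : Y → Ω} {a : Equiv.Perm Y} {b : Equiv.Perm Ω}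
    (h : Function.Semiconj ι a b) (k : ℤ) : Function.Semiconj ι ↑(a ^ k) ↑(b ^ k) := by
  have hpow : ∀ m : ℕ, Function.Semiconj ι ↑(a ^ m) ↑(b ^ m) := fun m => by
    simpa only [Equiv.Perm.iterate_eq_pow] using h.iterate_right m
  obtain ⟨m, rfl | rfl⟩ := k.eq_nat_or_neg
  · simpa only [zpow_natCast] using hpow m
  · simp only [zpow_neg, zpow_natCast]
    exact (hpow m).inverses_right (a ^ m).apply_symm_apply (b ^ m).symm_apply_apply

/-- In a nonzero common multiple of `u - 1` and `v - 1`, the longest point that the support reaches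
from `y₀` would be isolated either in its `⟨u⟩`-coset or in its `⟨v⟩`-coset. -/
theorem noCommonMultiple_subOne_of_pingPong {Y Ω : Type*} [Nonempty Y] (ρ : G →* Equiv.Perm Ω)
    {ι : Y → Ω} (hι : Function.Injective ι) {a b : Equiv.Perm Y} (hu : Function.Semiconj ι a (ρ u))
    (hv : Function.Semiconj ι b (ρ v)) {ℓ : Y → ℕ} (hℓ : IsPingPongLength ℓ a b) :
    NoCommonMultiple (subOne R u) (subOne R v) := by
  classical
  intro P huP hvP
  by_contra hP
  obtain ⟨g₀, hg₀⟩ := Finsupp.ne_iff.mp (mt MonoidAlgebra.coeff_eq_zero.mp hP)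
  obtain ⟨y₀⟩ := ‹Nonempty Y›
  let orbitPoint : G → Ω := fun g => ρ (g * g₀⁻¹) (ι y₀)
  obtain ⟨g, hg, hmax⟩ :=
    (P.coeff.support.filter fun g => orbitPoint g ∈ Set.range ι).exists_max_image
      (fun g => ℓ (Function.invFun ι (orbitPoint g))) ⟨g₀, by simpa [orbitPoint] using hg₀⟩
  simp only [Finset.mem_filter, Finsupp.mem_support_iff] at hg hmax
  obtain ⟨hPg, y, hy⟩ := hg
  rw [← hy, Function.leftInverse_invFun hι] at hmax
  have hnot : ∀ (w : G) (c : Equiv.Perm Y), Function.Semiconj ι c (ρ w) → subOne R w ∣ P →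
      ¬ ∀ k : ℤ, k ≠ 0 → ℓ y < ℓ ((c ^ k) y) := by
    intro w c hc hwP hgrow
    refine hPg (coeff_eq_zero_of_subOne_dvd hwP fun k hk => ?_)
    by_contra hPk
    have hpoint : orbitPoint (w ^ k * g) = ι ((c ^ k) y) := by
      rw [(semiconj_perm_zpow hc k).eq, hy, ← map_zpow]
      simp only [orbitPoint, map_mul, Equiv.Perm.mul_apply]
    have hle := hmax _ ⟨hPk, hpoint ▸ Set.mem_range_self _⟩
    rw [hpoint, Function.leftInverse_invFun hι] at hle
    exact (hgrow k (by rintro rfl; simp at hk)).not_ge hle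
  exact (hℓ y).elim (hnot u a hu huP) (hnot v b hv hvP)

variable (R) in
/-- The alternative that makes `u - 1` and `v - 1` behave like generators of a graph monoid. -/
def SplitPair (u v : G) : Prop :=
  u = v ∨ NoCommonMultiple (subOne R u) (subOne R v) ∨
    Commute u v ∧ ∀ a b : ℤ, u ^ a = v ^ b → a = 0

lemma SplitPair.map {H : Type*} [Group H] (e : G ≃* H) (h : SplitPair R u v) :
    SplitPair R (e u) (e v) := by
  have hsub : ∀ g, MonoidAlgebra.mapDomainRingEquiv R e (subOne R g) = subOne R (e g) := fun g => by
    simp [subOne]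
  obtain rfl | h | ⟨hc, hi⟩ := h
  · exact .inl rfl
  · refine .inr (.inl fun P hu hv => ?_)
    obtain ⟨Q, rfl⟩ := (MonoidAlgebra.mapDomainRingEquiv R e).surjective P
    rw [← hsub, map_dvd_iff] at hu hv
    rw [h Q hu hv, map_zero]
  · refine .inr (.inr ⟨hc.map e, fun a b hab => hi a b (e.injective ?_)⟩)
    rwa [map_zpow, map_zpow]

lemma SplitPair.of_map {H : Type*} [Group H] (e : G ≃* H) (h : SplitPair R (e u) (e v)) :
    SplitPair R u v := by
  simpa using h.map e.symm

lemma SplitPair.of_conj (r : G)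
    (h : SplitPair R (r⁻¹ * u * r) (r⁻¹ * v * r)) : SplitPair R u v :=
  .of_map (MulAut.conj r⁻¹) (by simpa only [MulAut.conj_apply, inv_inv] using h)

variable {X : Type*} {Γ : SimpleGraph X}

variable (R Γ) in
/-- The homomorphism from the graph monoid of `Γ` to the group ring that sends each vertex `x` to
`φ x - 1`, for a family `φ` of group elements that commute along the edges of `Γ`. -/
noncomputable def subOneHom (φ : X → G) (hφ : ∀ x y, Γ.Adj x y → Commute (φ x) (φ y)) :
    GraphMonoid Γ →* MonoidAlgebra R G :=
  PresentedMonoid.lift (fun x => subOne R (φ x)) (by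
    rintro _ _ ⟨x, y, h⟩
    have hcomm := ((hφ x y h).map (MonoidAlgebra.of R G)).sub_left (Commute.one_left _)
    simp only [map_mul, FreeMonoid.lift_eval_of]
    exact (hcomm.sub_right (Commute.one_right _)).eq)

theorem subOneHom_injective [Nontrivial R] {φ : X → G} (hφ : Function.Injective φ)
    (hadj : ∀ x y, Γ.Adj x y ↔ x ≠ y ∧ Commute (φ x) (φ y)) (hord : ∀ x, ¬ IsOfFinOrder (φ x))
    (hsplit : ∀ x y, SplitPair R (φ x) (φ y)) :
    Function.Injective (subOneHom R Γ φ fun x y h => ((hadj x y).mp h).2) := by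
  refine graphMonoidHom_injective (fun x => isLeftRegular_subOne (hord x))
    (fun x => not_subOne_dvd_one (φ x)) fun x y hxy => ?_
  obtain h | h | ⟨hc, hi⟩ := hsplit x y
  · exact absurd (hφ h) hxy
  · exact .inl h
  · exact .inr ⟨(hadj x y).mpr ⟨hxy, hc⟩, fun P => subOne_dvd_of_dvd_subOne_mul hc hi⟩

end GroupRing

section FreeGroupWords

open FreeGroup (of)

variable {α : Type*} [DecidableEq α] {x y : FreeGroup α} {z : α}

/-- The generator underlying the first letter of the reduced word of `x`. -/
def firstGen (x : FreeGroup α) : Option α := x.toWord.head?.map Prod.fst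

/-- The generator underlying the last letter of the reduced word of `x`. -/
def lastGen (x : FreeGroup α) : Option α := x.toWord.getLast?.map Prod.fst

lemma lastGen_inv (x : FreeGroup α) : lastGen x⁻¹ = firstGen x := by
  rw [lastGen, firstGen, FreeGroup.toWord_inv, FreeGroup.invRev, List.getLast?_reverse,
    List.head?_map]
  cases x.toWord.head? <;> rfl

lemma firstGen_inv (x : FreeGroup α) : firstGen x⁻¹ = lastGen x := by
  rw [← lastGen_inv, inv_inv]

lemma firstGen_eq_none_iff : firstGen x = none ↔ x = 1 := by
  simp [firstGen]

lemma toWord_mul_of_ends_ne (h : ∀ a ∈ lastGen x, firstGen y ≠ some a) :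
    (x * y).toWord = x.toWord ++ y.toWord := by
  rw [FreeGroup.toWord_mul]
  refine FreeGroup.IsReduced.reduce_eq (List.isChain_append.mpr
    ⟨FreeGroup.isReduced_toWord, FreeGroup.isReduced_toWord, fun a ha b hb hab => ?_⟩)
  refine absurd ?_ (h a.1 ?_)
  · rw [firstGen, Option.mem_def.mp hb, hab]; rfl
  · rw [lastGen, Option.mem_def.mp ha]; rfl

lemma firstGen_mul_of_ends_ne (hx : x ≠ 1) (h : ∀ a ∈ lastGen x, firstGen y ≠ some a) :
    firstGen (x * y) = firstGen x := by
  rw [firstGen, toWord_mul_of_ends_ne h, List.head?_append_of_ne_nil _ (by simpa using hx),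
    firstGen]

lemma norm_mul_of_ends_ne (h : ∀ a ∈ lastGen x, firstGen y ≠ some a) :
    (x * y).norm = x.norm + y.norm := by
  simp only [FreeGroup.norm, toWord_mul_of_ends_ne h, List.length_append]

lemma toWord_of_zpow (a : α) (k : ℤ) :
    (of a ^ k).toWord = List.replicate k.natAbs (a, decide (0 ≤ k)) := by
  obtain ⟨m, rfl | rfl⟩ := k.eq_nat_or_neg
  · simp [FreeGroup.toWord_of_pow]
  · rw [zpow_neg, zpow_natCast, FreeGroup.toWord_inv, FreeGroup.toWord_of_pow]
    obtain rfl | hm := Nat.eq_zero_or_pos m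
    · rfl
    · simp [FreeGroup.invRev, hm.ne']

lemma firstGen_of_zpow (a : α) {k : ℤ} (hk : k ≠ 0) : firstGen (of a ^ k) = some a := by
  obtain ⟨m, hm⟩ := Nat.exists_eq_succ_of_ne_zero (Int.natAbs_ne_zero.mpr hk)
  rw [firstGen, toWord_of_zpow, hm]
  rfl

lemma lastGen_of_zpow (a : α) {k : ℤ} (hk : k ≠ 0) : lastGen (of a ^ k) = some a := by
  rw [← firstGen_inv, ← zpow_neg, firstGen_of_zpow a (neg_ne_zero.mpr hk)]

lemma mk_singleton_eq_zpow {α : Type*} (s : α × Bool) :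
    ∃ k : ℤˣ, FreeGroup.mk [s] = of s.1 ^ (k : ℤ) := by
  obtain ⟨a, _ | _⟩ := s
  · exact ⟨-1, by rw [Units.val_neg, Units.val_one, zpow_neg_one]; rfl⟩
  · exact ⟨1, by rw [Units.val_one, zpow_one]; rfl⟩

lemma exists_toWord_eq_cons {a : α} (h : firstGen x = some a) :
    ∃ (k : ℤ) (e : Bool), x.toWord = (a, e) :: (of a ^ k * x).toWord := by
  rw [firstGen, Option.map_eq_some_iff] at h
  obtain ⟨s, h, rfl⟩ := h
  obtain ⟨t, ht⟩ := List.head?_eq_some_iff.mp h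
  obtain ⟨k, hk⟩ := mk_singleton_eq_zpow s
  have hred : FreeGroup.IsReduced (s :: t) := ht ▸ FreeGroup.isReduced_toWord
  have htail : of s.1 ^ (-k : ℤ) * x = FreeGroup.mk t := by
    rw [← FreeGroup.mk_toWord (x := x), ht, zpow_neg, inv_mul_eq_iff_eq_mul, ← hk,
      FreeGroup.mul_mk]
    rfl
  refine ⟨-k, s.2, ?_⟩
  rw [htail, FreeGroup.toWord_mk, (hred.infix (List.suffix_cons _ _).isInfix).reduce_eq, ht]

lemma exists_norm_zpow_mul_lt {a : α} (h : firstGen x = some a) :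
    ∃ k : ℤ, (of a ^ k * x).norm < x.norm := by
  obtain ⟨k, e, he⟩ := exists_toWord_eq_cons h
  exact ⟨k, by simp [FreeGroup.norm, he]⟩

/-- The number of occurrences of the generator `z` in the reduced word of `x`. -/
def genCount (z : α) (x : FreeGroup α) : ℕ := x.toWord.countP (·.1 = z)

lemma genCount_one : genCount z 1 = 0 := rfl

lemma genCount_inv (x : FreeGroup α) : genCount z x⁻¹ = genCount z x := by
  rw [genCount, FreeGroup.toWord_inv, FreeGroup.invRev, List.countP_reverse, List.countP_map,
    genCount]
  rfl

lemma genCount_mul_le (x y : FreeGroup α) : genCount z (x * y) ≤ genCount z x + genCount z y := by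
  rw [genCount, genCount, genCount, ← List.countP_append]
  exact (FreeGroup.toWord_mul_sublist x y).countP_le

lemma genCount_mul_of_ends_ne (h : ∀ a ∈ lastGen x, firstGen y ≠ some a) :
    genCount z (x * y) = genCount z x + genCount z y := by
  simp only [genCount, toWord_mul_of_ends_ne h, List.countP_append]

lemma genCount_of_zpow (z a : α) (k : ℤ) :
    genCount z (of a ^ k) = if a = z then k.natAbs else 0 := by
  rw [genCount, toWord_of_zpow, List.countP_replicate]
  simp

lemma firstGen_eq_some_iff :
    firstGen x = some z ↔ ∃ k : ℤ, genCount z (of z ^ k * x) < genCount z x := by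
  constructor
  · intro h
    obtain ⟨k, e, he⟩ := exists_toWord_eq_cons h
    exact ⟨k, by simp [genCount, he]⟩
  · rintro ⟨k, hk⟩
    by_contra h
    have hk0 : k ≠ 0 := by rintro rfl; simp at hk
    rw [genCount_mul_of_ends_ne (by simpa [lastGen_of_zpow z hk0] using h)] at hk
    omega

/-- The elements of the free group whose reduced word does not involve the generator `z`. -/
def avoiding (z : α) : Subgroup (FreeGroup α) where
  carrier := {x | genCount z x = 0}
  one_mem' := genCount_one
  mul_mem' {x y} hx hy := by
    have := genCount_mul_le (z := z) x y
    simp only [Set.mem_ofPred_eq] at hx hy ⊢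
    omega
  inv_mem' {x} hx := (genCount_inv x).trans hx

lemma mem_avoiding_iff : x ∈ avoiding z ↔ genCount z x = 0 := Iff.rfl

lemma of_mem_avoiding {a : α} (ha : a ≠ z) : of a ∈ avoiding z := by
  simpa [mem_avoiding_iff, ha] using genCount_of_zpow z a 1

lemma avoiding_le_closure (z : α) : avoiding z ≤ Subgroup.closure (of '' {a | a ≠ z}) := by
  intro x hx
  rw [mem_avoiding_iff, genCount, List.countP_eq_zero] at hx
  rw [← FreeGroup.mk_toWord (x := x)]
  generalize x.toWord = L at hx
  induction L with
  | nil => exact one_mem _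
  | cons s t ih =>
    obtain ⟨k, hk⟩ := mk_singleton_eq_zpow s
    have hs : s.1 ≠ z := by simpa using hx s List.mem_cons_self
    rw [← List.singleton_append, ← FreeGroup.mul_mk, hk]
    exact mul_mem (zpow_mem (Subgroup.subset_closure (Set.mem_image_of_mem of hs)) k)
      (ih fun b hb => hx b (List.mem_cons_of_mem _ hb))

lemma genCount_mul_left (hx : x ∈ avoiding z) (y : FreeGroup α) :
    genCount z (x * y) = genCount z y := by
  have hle := genCount_mul_le (z := z) x y
  have hge := genCount_mul_le (z := z) x⁻¹ (x * y)
  rw [inv_mul_cancel_left, genCount_inv] at hge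
  rw [mem_avoiding_iff] at hx
  omega

lemma genCount_mul_right (hy : y ∈ avoiding z) (x : FreeGroup α) :
    genCount z (x * y) = genCount z x := by
  rw [← genCount_inv, mul_inv_rev, genCount_mul_left (inv_mem hy), genCount_inv]

lemma firstGen_ne_of_mem_avoiding (hx : x ∈ avoiding z) : firstGen x ≠ some z := by
  rw [Ne, firstGen_eq_some_iff, mem_avoiding_iff.mp hx]
  simp

lemma lastGen_ne_of_mem_avoiding (hx : x ∈ avoiding z) : lastGen x ≠ some z := by
  rw [← firstGen_inv]
  exact firstGen_ne_of_mem_avoiding (inv_mem hx)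

lemma firstGen_mul_of_mem_avoiding (hx : x ∈ avoiding z) (hx1 : x ≠ 1) (hy : firstGen y = some z) :
    firstGen (x * y) ≠ some z := by
  rw [firstGen_mul_of_ends_ne hx1]
  · exact firstGen_ne_of_mem_avoiding hx
  · rintro a ha hya
    rw [Option.some.inj (hya.symm.trans hy)] at ha
    exact lastGen_ne_of_mem_avoiding hx ha

lemma genCount_map_le {φ : FreeGroup α →* FreeGroup α} (hz : genCount z (φ (of z)) ≤ 1)
    (ha : ∀ a ≠ z, φ (of a) ∈ avoiding z) (x : FreeGroup α) :
    genCount z (φ x) ≤ genCount z x := by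
  have hword : ∀ L, genCount z (φ (FreeGroup.mk L)) ≤ L.countP (·.1 = z) := by
    intro L
    induction L with
    | nil => exact (congrArg (genCount z) (map_one φ)).le
    | cons s t ih =>
      obtain ⟨k, hk⟩ := mk_singleton_eq_zpow s
      rw [← List.singleton_append, ← FreeGroup.mul_mk, map_mul, hk, map_zpow,
        List.singleton_append, List.countP_cons, add_comm]
      refine (genCount_mul_le _ _).trans (Nat.add_le_add ?_ ih)
      by_cases hs : s.1 = z
      · obtain rfl | rfl := Int.units_eq_one_or k <;> simpa [hs, genCount_inv] using hz
      · rw [mem_avoiding_iff.mp (zpow_mem (ha s.1 hs) _)]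
        exact Nat.zero_le _
  simpa only [FreeGroup.mk_toWord, genCount] using hword x.toWord

/-- The endomorphism that conjugates the generator `z` by `q` and fixes all other generators. -/
def twistHom (z : α) (q : FreeGroup α) : FreeGroup α →* FreeGroup α :=
  FreeGroup.lift fun a => if a = z then q⁻¹ * of z * q else of a

@[simp]
lemma twistHom_self (z : α) (q : FreeGroup α) : twistHom z q (of z) = q⁻¹ * of z * q := by
  simp [twistHom]

lemma twistHom_of_ne {a : α} (ha : a ≠ z) (q : FreeGroup α) : twistHom z q (of a) = of a := by
  simp [twistHom, ha]

lemma twistHom_of_mem_avoiding (q : FreeGroup α) (hx : x ∈ avoiding z) : twistHom z q x = x := by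
  refine MonoidHom.eqOn_closure (f := twistHom z q) (g := MonoidHom.id _) ?_
    (avoiding_le_closure z hx)
  rintro _ ⟨a, ha, rfl⟩
  exact twistHom_of_ne ha q

lemma twistHom_comp {p : FreeGroup α} (q : FreeGroup α) (hq : q ∈ avoiding z) :
    (twistHom z p).comp (twistHom z q) = twistHom z (p * q) := by
  ext a
  obtain rfl | ha := eq_or_ne a z
  · simp [twistHom_of_mem_avoiding p hq, mul_assoc]
  · simp [twistHom_of_ne ha]

lemma twistHom_one (z : α) : twistHom z 1 = MonoidHom.id (FreeGroup α) := by
  ext a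
  obtain rfl | ha := eq_or_ne a z
  · simp
  · simp [twistHom_of_ne ha]

/-- The automorphisms that conjugate the generator `z` by an element avoiding `z` and fix all other
generators. -/
def twist (z : α) : avoiding z →* MulAut (FreeGroup α) where
  toFun q := (twistHom z q).toMulEquiv (twistHom z (q⁻¹ : avoiding z))
    (by rw [twistHom_comp _ q.2, ← Subgroup.coe_mul, inv_mul_cancel, Subgroup.coe_one,
      twistHom_one])
    (by rw [twistHom_comp _ (q⁻¹).2, ← Subgroup.coe_mul, mul_inv_cancel, Subgroup.coe_one,
      twistHom_one])
  map_one' := MulEquiv.ext fun x => DFunLike.congr_fun (twistHom_one z) x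
  map_mul' p q := MulEquiv.ext fun x =>
    DFunLike.congr_fun (twistHom_comp (p := (p : FreeGroup α)) q q.2).symm x

lemma twist_self (q : avoiding z) : twist z q (of z) = (q : FreeGroup α)⁻¹ * of z * q :=
  twistHom_self z q

lemma twist_of_ne {a : α} (ha : a ≠ z) (q : avoiding z) : twist z q (of a) = of a :=
  twistHom_of_ne ha q

lemma twist_of_mem_avoiding (q : avoiding z) (hx : x ∈ avoiding z) : twist z q x = x :=
  twistHom_of_mem_avoiding (q : FreeGroup α) hx

lemma genCount_twist (q : avoiding z) (x : FreeGroup α) :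
    genCount z (twist z q x) = genCount z x := by
  have hle : ∀ (q : avoiding z) x, genCount z (twist z q x) ≤ genCount z x := fun q =>
    genCount_map_le (φ := (twist z q).toMonoidHom)
      (by
        change genCount z (twist z q (of z)) ≤ 1
        rw [twist_self, genCount_mul_right q.2, genCount_mul_left (inv_mem q.2)]
        simpa using (genCount_of_zpow z z 1).le)
      fun a ha => by
        change twist z q (of a) ∈ avoiding z
        rw [twist_of_ne ha]
        exact of_mem_avoiding ha
  refine (hle q x).antisymm ?_
  simpa [← MulAut.mul_apply, ← map_mul] using hle q⁻¹ (twist z q x)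

/-- `l` is the part of the reduced word of `x` before the first occurrence of the generator `z`. -/
def IsLeadingSyllable (z : α) (l x : FreeGroup α) : Prop :=
  l ∈ avoiding z ∧ firstGen (l⁻¹ * x) = some z

lemma exists_isLeadingSyllable (hx : x ∉ avoiding z) : ∃ l, IsLeadingSyllable z l x := by
  obtain ⟨l, hl, hmin⟩ := WellFounded.has_min (measure fun l : FreeGroup α => (l⁻¹ * x).norm).wf
    (avoiding z : Set (FreeGroup α)) ⟨1, one_mem _⟩
  refine ⟨l, hl, ?_⟩
  cases ha : firstGen (l⁻¹ * x) with
  | none =>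
    rw [firstGen_eq_none_iff, inv_mul_eq_one] at ha
    exact absurd (ha ▸ hl) hx
  | some a =>
    by_contra hne
    obtain ⟨k, hk⟩ := exists_norm_zpow_mul_lt ha
    have haz : a ≠ z := fun h => hne (congrArg some h)
    refine hmin _ (mul_mem hl (zpow_mem (of_mem_avoiding haz) (-k))) ?_
    change ((l * of a ^ (-k))⁻¹ * x).norm < (l⁻¹ * x).norm
    rwa [mul_inv_rev, zpow_neg, inv_inv, mul_assoc]

lemma IsLeadingSyllable.eq {l l' : FreeGroup α} (h : IsLeadingSyllable z l x)
    (h' : IsLeadingSyllable z l' x) : l = l' := by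
  by_contra hne
  refine firstGen_mul_of_mem_avoiding (mul_mem (inv_mem h'.1) h.1)
    (fun h1 => hne (inv_mul_eq_one.mp h1).symm) h.2 ?_
  rw [mul_assoc, mul_inv_cancel_left]
  exact h'.2

lemma IsLeadingSyllable.mul_left {l m : FreeGroup α} (h : IsLeadingSyllable z l x)
    (hm : m ∈ avoiding z) : IsLeadingSyllable z (m * l) (m * x) := by
  refine ⟨mul_mem hm h.1, ?_⟩
  rw [mul_inv_rev, mul_assoc, inv_mul_cancel_left]
  exact h.2

lemma firstGen_mul_twist (q : avoiding z) (hx : firstGen x = some z) :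
    firstGen ((q : FreeGroup α) * twist z q x) = some z := by
  obtain ⟨k, hk⟩ := firstGen_eq_some_iff.mp hx
  refine firstGen_eq_some_iff.mpr ⟨k, ?_⟩
  have hconj : twist z q (of z ^ k) = (q : FreeGroup α)⁻¹ * of z ^ k * q := by
    simpa only [map_zpow, twist_self, inv_inv] using conj_zpow (i := k) (a := (q : FreeGroup α)⁻¹)
  have htwist : of z ^ k * (q * twist z q x) = q * twist z q (of z ^ k * x) := by
    rw [map_mul, hconj]
    group
  rwa [htwist, genCount_mul_left q.2, genCount_mul_left q.2, genCount_twist, genCount_twist]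

lemma IsLeadingSyllable.twist {l : FreeGroup α} (h : IsLeadingSyllable z l x) (q : avoiding z) :
    IsLeadingSyllable z (l * (q : FreeGroup α)⁻¹) (twist z q x) := by
  refine ⟨mul_mem h.1 (inv_mem q.2), ?_⟩
  rw [mul_inv_rev, inv_inv, mul_assoc, ← twist_of_mem_avoiding q (inv_mem h.1), ← map_mul]
  exact firstGen_mul_twist q h.2

lemma exists_common_leadingSyllable (h : genCount z (x * y) ≠ genCount z x + genCount z y) :
    ∃ l, IsLeadingSyllable z l x⁻¹ ∧ IsLeadingSyllable z l y := by
  obtain ⟨l, hl⟩ := exists_isLeadingSyllable (z := z) (x := x⁻¹) fun hx => h (by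
    rw [inv_mem_iff] at hx
    rw [genCount_mul_left hx, mem_avoiding_iff.mp hx, zero_add])
  obtain ⟨m, hm⟩ := exists_isLeadingSyllable (z := z) (x := y) fun hy =>
    h (by rw [genCount_mul_right hy, mem_avoiding_iff.mp hy, add_zero])
  obtain rfl | hlm := eq_or_ne l m
  · exact ⟨l, hl, hm⟩
  refine absurd ?_ h
  have hmid : l⁻¹ * m ∈ avoiding z := mul_mem (inv_mem hl.1) hm.1
  have hsplit : x * y = (l⁻¹ * x⁻¹)⁻¹ * ((l⁻¹ * m) * (m⁻¹ * y)) := by group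
  rw [hsplit, genCount_mul_of_ends_ne, genCount_inv, genCount_mul_left hmid,
    genCount_mul_left (inv_mem hl.1), genCount_mul_left (inv_mem hm.1), genCount_inv]
  rw [lastGen_inv, hl.2]
  rintro _ ⟨⟩
  exact firstGen_mul_of_mem_avoiding hmid (fun h1 => hlm (inv_mul_eq_one.mp h1)) hm.2

lemma genCount_mul_zpow_mul (h : genCount z (x * y) ≠ genCount z x + genCount z y)
    {p : avoiding z} (hp : p ≠ 1) {k : ℤ} (hk : k ≠ 0) :
    genCount z (x * (p ^ k * y)) = genCount z x + genCount z y := by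
  obtain ⟨l, hlx, hly⟩ := exists_common_leadingSyllable h
  by_contra hpow
  rw [← genCount_mul_left (zpow_mem p.2 k) y] at hpow
  obtain ⟨m, hmx, hmy⟩ := exists_common_leadingSyllable hpow
  have hfix : (p : FreeGroup α) ^ k * l = l :=
    (hly.mul_left (zpow_mem p.2 k)).eq hmy |>.trans (hmx.eq hlx)
  exact hk ((IsMulTorsionFree.zpow_eq_one_iff_right (by simpa using hp)).mp
    (mul_eq_right.mp hfix))

lemma genCount_mul_twist_zpow (h : genCount z (x * y) ≠ genCount z x + genCount z y)
    {q : avoiding z} (hq : q ≠ 1) {k : ℤ} (hk : k ≠ 0) :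
    genCount z (x * twist z (q ^ k) y) = genCount z x + genCount z y := by
  obtain ⟨l, hlx, hly⟩ := exists_common_leadingSyllable h
  by_contra hpow
  rw [← genCount_twist (q ^ k) y] at hpow
  obtain ⟨m, hmx, hmy⟩ := exists_common_leadingSyllable hpow
  have hfix : l * ((q ^ k : avoiding z) : FreeGroup α)⁻¹ = l :=
    (hly.twist (q ^ k)).eq hmy |>.trans (hmx.eq hlx)
  rw [mul_eq_left, inv_eq_one, Subgroup.coe_zpow] at hfix
  exact hk ((IsMulTorsionFree.zpow_eq_one_iff_right (by simpa using hq)).mp hfix)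

theorem isPingPongLength_twist {p q : avoiding z} (hp : p ≠ 1) (hq : q ≠ 1) {f : FreeGroup α}
    (hf : f ∉ avoiding z) :
    IsPingPongLength (fun x => genCount z x + genCount z (f⁻¹ * x))
      (MulAut.toPerm _ (twist z q)) (Equiv.mulLeft (f * p * f⁻¹)) := by
  rw [mem_avoiding_iff] at hf
  intro x
  by_cases hadd : genCount z (f⁻¹ * x) = genCount z f⁻¹ + genCount z x
  · right
    intro k hk
    obtain ⟨y, rfl⟩ : ∃ y, x = f * y := ⟨f⁻¹ * x, (mul_inv_cancel_left f x).symm⟩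
    simp only [inv_mul_cancel_left, genCount_inv] at hadd
    have hpow : genCount z (f * (p ^ k * y)) = genCount z f + genCount z y :=
      genCount_mul_zpow_mul (by omega) hp hk
    have hmul : (f * p * f⁻¹) ^ k * (f * y) = f * (p ^ k * y) := by rw [conj_zpow]; group
    simp only [Equiv.zpow_mulLeft, Equiv.coe_mulLeft, hmul, inv_mul_cancel_left, hpow,
      genCount_mul_left (zpow_mem p.2 k)]
    omega
  · left
    intro k hk
    have hle := genCount_mul_le (z := z) f⁻¹ x
    rw [← map_zpow, ← map_zpow]
    change genCount z x + genCount z (f⁻¹ * x) <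
      genCount z (twist z (q ^ k) x) + genCount z (f⁻¹ * twist z (q ^ k) x)
    rw [genCount_mul_twist_zpow hadd hq hk, genCount_twist]
    omega

lemma exists_trimmed (i j : α) (f : FreeGroup α) :
    ∃ (a b : ℤ) (f₀ : FreeGroup α), f = of i ^ a * f₀ * of j ^ b ∧
      firstGen f₀ ≠ some i ∧ lastGen f₀ ≠ some j := by
  obtain ⟨⟨a, b⟩, -, hmin⟩ := WellFounded.has_min
    (measure fun p : ℤ × ℤ => (of i ^ p.1 * f * of j ^ p.2).norm).wf Set.univ ⟨0, trivial⟩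
  refine ⟨-a, -b, of i ^ a * f * of j ^ b, by group, fun h => ?_, fun h => ?_⟩
  · obtain ⟨k, hk⟩ := exists_norm_zpow_mul_lt h
    refine hmin (k + a, b) trivial ?_
    change (of i ^ (k + a) * f * of j ^ b).norm < _
    simpa only [zpow_add, mul_assoc] using hk
  · rw [← firstGen_inv] at h
    obtain ⟨k, hk⟩ := exists_norm_zpow_mul_lt h
    refine hmin (a, b - k) trivial ?_
    change (of i ^ a * f * of j ^ (b - k)).norm < _
    rw [FreeGroup.norm_inv_eq, ← FreeGroup.norm_inv_eq] at hk
    convert hk using 2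
    group

lemma isPingPongLength_norm {i j : α} {f : FreeGroup α} (hi : firstGen f ≠ some i)
    (hj : lastGen f ≠ some j) (hne : f ≠ 1 ∨ i ≠ j) :
    IsPingPongLength FreeGroup.norm (Equiv.mulLeft (of i)) (Equiv.mulLeft (f * of j * f⁻¹)) := by
  intro x
  simp only [Equiv.zpow_mulLeft, Equiv.coe_mulLeft, conj_zpow]
  have hnorm : ∀ (a : α) {k : ℤ}, k ≠ 0 → 0 < (of a ^ k).norm := fun a k hk => by
    simpa [FreeGroup.norm, toWord_of_zpow] using hk
  by_cases hx : firstGen x = some i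
  · right
    intro k hk
    have hfx : ∀ a ∈ lastGen f⁻¹, firstGen x ≠ some a := by
      rw [lastGen_inv, hx]
      rintro a ha ⟨⟩
      exact hi ha
    have hjfx : firstGen (f⁻¹ * x) ≠ some j := by
      by_cases hf : f = 1
      · simpa [hf, hx] using hne
      · rwa [firstGen_mul_of_ends_ne (inv_ne_one.mpr hf) hfx, firstGen_inv]
    have hpow : ∀ a ∈ lastGen (of j ^ k), firstGen (f⁻¹ * x) ≠ some a := by
      simpa [lastGen_of_zpow j hk] using hjfx
    have hpow1 : of j ^ k ≠ 1 := by
      rw [Ne, ← firstGen_eq_none_iff, firstGen_of_zpow j hk]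
      exact Option.some_ne_none j
    rw [mul_assoc, mul_assoc, norm_mul_of_ends_ne, norm_mul_of_ends_ne hpow,
      norm_mul_of_ends_ne hfx]
    · have := hnorm j hk
      omega
    · rw [firstGen_mul_of_ends_ne hpow1 hpow, firstGen_of_zpow j hk]
      rintro a ha ⟨⟩
      exact hj ha
  · left
    intro k hk
    rw [norm_mul_of_ends_ne (by simpa [lastGen_of_zpow i hk] using hx)]
    have := hnorm i hk
    omega

theorem of_eq_conj_or_exists_isPingPongLength {α : Type*} (i j : α) (f : FreeGroup α) :
    of i = f * of j * f⁻¹ ∨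
      ∃ ℓ, IsPingPongLength ℓ (Equiv.mulLeft (of i)) (Equiv.mulLeft (f * of j * f⁻¹)) := by
  classical
  obtain ⟨a, b, f₀, rfl, hi, hj⟩ := exists_trimmed i j f
  have hconj : of i ^ a * f₀ * of j ^ b * of j * (of i ^ a * f₀ * of j ^ b)⁻¹ =
      of i ^ a * (f₀ * of j * f₀⁻¹) * (of i ^ a)⁻¹ := by group
  rw [hconj]
  by_cases htriv : f₀ = 1 ∧ i = j
  · left
    obtain ⟨rfl, rfl⟩ := htriv
    group
  · right
    refine ⟨fun x => (of i ^ (-a) * x).norm, fun x => ?_⟩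
    have hpp := isPingPongLength_norm hi hj (not_and_or.mp htriv) (of i ^ (-a) * x)
    simp only [Equiv.zpow_mulLeft, Equiv.coe_mulLeft] at hpp ⊢
    have hcomm : ∀ k : ℤ, of i ^ (-a) * (of i ^ k * x) = of i ^ k * (of i ^ (-a) * x) := fun k => by
      group
    have hcancel : ∀ k : ℤ, of i ^ (-a) * ((of i ^ a * (f₀ * of j * f₀⁻¹) * (of i ^ a)⁻¹) ^ k * x) =
        (f₀ * of j * f₀⁻¹) ^ k * (of i ^ (-a) * x) := fun k => by
      rw [conj_zpow]
      group
    simpa only [hcomm, hcancel] using hpp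

end FreeGroupWords

section BraidGroup

open FreeGroup (of)

variable {n : ℕ}

/-- Artin's generators of the braid group, indexed from `0` by all natural numbers; the out-of-range
ones are trivial. -/
def sigma (n k : ℕ) : BraidGroup n := if h : k < n - 1 then braidGen n ⟨k, h⟩ else 1

lemma sigma_of_lt {k : ℕ} (h : k < n - 1) : sigma n k = braidGen n ⟨k, h⟩ := dif_pos h

lemma sigma_of_le {k : ℕ} (h : n - 1 ≤ k) : sigma n k = 1 := dif_neg h.not_gt

lemma sigma_commute {j k : ℕ} (h : j + 1 < k) : Commute (sigma n j) (sigma n k) := by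
  obtain hk | hk := lt_or_ge k (n - 1)
  · have hj : j < n - 1 := by omega
    rw [sigma_of_lt hk, sigma_of_lt hj]
    refine PresentedGroup.mk_eq_mk_of_mul_inv_mem (.inl ⟨⟨j, hj⟩, ⟨k, hk⟩, ?_, rfl⟩)
    exact lt_abs.mpr (.inr (by simp only; omega))
  · rw [sigma_of_le hk]
    exact Commute.one_right _

lemma sigma_braid {k : ℕ} (h : k + 1 < n - 1) :
    sigma n k * sigma n (k + 1) * sigma n k = sigma n (k + 1) * sigma n k * sigma n (k + 1) := by
  have hk : k < n - 1 := by omega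
  rw [sigma_of_lt hk, sigma_of_lt h]
  exact PresentedGroup.mk_eq_mk_of_mul_inv_mem (.inr ⟨⟨k, hk⟩, ⟨k + 1, h⟩, by simp, rfl⟩)

theorem braid_induction {p : BraidGroup n → Prop} (sigma : ∀ k < n - 1, p (sigma n k)) (one : p 1)
    (mul : ∀ g h, p g → p h → p (g * h)) (inv : ∀ g, p g → p g⁻¹) (g : BraidGroup n) : p g := by
  have hg : g ∈ Subgroup.closure (Set.range (PresentedGroup.of (rels := braidRels n))) := by
    rw [PresentedGroup.closure_range_of]
    trivial
  induction hg using Subgroup.closure_induction with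
  | mem x hx =>
    obtain ⟨k, rfl⟩ := hx
    have hk := sigma k k.2
    rwa [sigma_of_lt k.2] at hk
  | one => exact one
  | mul x y _ _ hx hy => exact mul x y hx hy
  | inv x _ hx => exact inv x hx

/-- The homomorphism from the braid group on `n` strings defined by an infinite sequence that
satisfies the braid relations. -/
def braidLift {H : Type*} [Group H] (n : ℕ) (f : ℕ → H)
    (hcomm : ∀ j k, j + 1 < k → Commute (f j) (f k))
    (hbraid : ∀ k, f k * f (k + 1) * f k = f (k + 1) * f k * f (k + 1)) : BraidGroup n →* H :=
  PresentedGroup.toGroup (f := fun i : Fin (n - 1) => f i) (by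
    rintro r (⟨j, k, hjk, rfl⟩ | ⟨j, k, hjk, rfl⟩) <;>
      simp only [map_mul, map_inv, FreeGroup.lift_apply_of, mul_inv_eq_one]
    · obtain h | h := lt_abs.mp hjk
      · exact (hcomm k j (by omega)).symm
      · exact hcomm j k (by omega)
    · obtain h | h := (abs_eq zero_le_one).mp hjk
      · rw [show (j : ℕ) = k + 1 by omega]
        exact (hbraid k).symm
      · rw [show (k : ℕ) = j + 1 by omega]
        exact hbraid j)

lemma braidLift_sigma {H : Type*} [Group H] {f : ℕ → H}
    (hcomm : ∀ j k, j + 1 < k → Commute (f j) (f k))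
    (hbraid : ∀ k, f k * f (k + 1) * f k = f (k + 1) * f k * f (k + 1)) {k : ℕ} (hk : k < n - 1) :
    braidLift n f hcomm hbraid (sigma n k) = f k := by
  rw [sigma_of_lt hk]
  exact PresentedGroup.toGroup.of _

/-- The exponent sum of a braid. -/
def braidDegree (n : ℕ) : BraidGroup n →* Multiplicative ℤ :=
  braidLift n (fun _ => .ofAdd 1) (fun _ _ _ => rfl) (fun _ => rfl)

lemma isConj_of_braid {G : Type*} [Group G] {a b : G} (h : a * b * a = b * a * b) : IsConj a b :=
  isConj_iff.mpr ⟨a * b, by rw [h]; group⟩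

lemma isConj_sigma_zero {k : ℕ} (hk : k < n - 1) : IsConj (sigma n 0) (sigma n k) := by
  induction k with
  | zero => exact IsConj.refl _
  | succ k ih => exact (ih (by omega)).trans (isConj_of_braid (sigma_braid hk))

lemma isConj_sq_of_mem_conjSquares {u : BraidGroup n} (hu : u ∈ conjSquares n) {k : ℕ}
    (hk : k < n - 1) : IsConj (sigma n k ^ 2) u := by
  obtain ⟨a, i, rfl⟩ := hu
  rw [← sigma_of_lt i.2]
  exact (((isConj_sigma_zero hk).symm.trans (isConj_sigma_zero i.2)).pow 2).trans
    (isConj_iff.mpr ⟨a, rfl⟩)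

lemma not_isOfFinOrder_of_mem_conjSquares {u : BraidGroup n} (hu : u ∈ conjSquares n) :
    ¬ IsOfFinOrder u := by
  intro h
  obtain ⟨a, i, rfl⟩ := hu
  have hdeg : braidDegree n (braidGen n i) = .ofAdd 1 := by
    rw [← sigma_of_lt i.2]
    exact braidLift_sigma _ _ i.2
  have hone := (isOfFinOrder_iff_eq_one ..).mp ((braidDegree n).isOfFinOrder h)
  rw [map_mul, map_mul, map_inv, mul_comm, inv_mul_cancel_left, map_pow, hdeg] at hone
  exact absurd hone (by decide)

lemma commute_swap_swap {j k : ℕ} (h : j + 1 < k) :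
    Commute (Equiv.swap j (j + 1)) (Equiv.swap k (k + 1)) := by
  ext i
  simp only [Equiv.Perm.mul_apply, Equiv.swap_apply_def]
  split_ifs <;> omega

lemma swap_braid (k : ℕ) :
    Equiv.swap k (k + 1) * Equiv.swap (k + 1) (k + 1 + 1) * Equiv.swap k (k + 1) =
      Equiv.swap (k + 1) (k + 1 + 1) * Equiv.swap k (k + 1) * Equiv.swap (k + 1) (k + 1 + 1) := by
  ext i
  simp only [Equiv.Perm.mul_apply, Equiv.swap_apply_def]
  split_ifs <;> omega

/-- The permutation of the strands induced by a braid; the strands of `BraidGroup n` are numbered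
from `0` to `n - 1`, and all larger numbers are fixed. -/
def braidPerm (n : ℕ) : BraidGroup n →* Equiv.Perm ℕ :=
  braidLift n (fun k => Equiv.swap k (k + 1)) (fun _ _ => commute_swap_swap) swap_braid

lemma braidPerm_sigma {k : ℕ} (hk : k < n - 1) :
    braidPerm n (sigma n k) = Equiv.swap k (k + 1) := braidLift_sigma _ _ hk

lemma braidPerm_le_iff (g : BraidGroup n) {i : ℕ} : braidPerm n g i ≤ n - 1 ↔ i ≤ n - 1 := by
  induction g using braid_induction generalizing i with
  | sigma k hk =>
    rw [braidPerm_sigma hk, Equiv.swap_apply_def]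
    split_ifs <;> omega
  | one => simp
  | mul g h hg hh => rw [map_mul, Equiv.Perm.mul_apply, hg, hh]
  | inv g hg => rw [← hg, ← Equiv.Perm.mul_apply, ← map_mul, mul_inv_cancel, map_one,
      Equiv.Perm.one_apply]

/-- The automorphism by which the `k`-th generator of the braid group acts on the free group in
Artin's representation. -/
def artin (k : ℕ) : MulAut (FreeGroup ℕ) :=
  MonoidHom.toMulEquiv
    (FreeGroup.lift fun i =>
      if i = k then (of k)⁻¹ * of (k + 1) * of k else if i = k + 1 then of k else of i)
    (FreeGroup.lift fun i =>
      if i = k then of (k + 1) else if i = k + 1 then of (k + 1) * of k * (of (k + 1))⁻¹ else of i)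
    (by
      ext i
      obtain rfl | h := eq_or_ne i k
      · simp [mul_assoc]
      obtain rfl | h' := eq_or_ne i (k + 1)
      · simp
      · simp [h, h'])
    (by
      ext i
      obtain rfl | h := eq_or_ne i k
      · simp
      obtain rfl | h' := eq_or_ne i (k + 1)
      · simp [mul_assoc]
      · simp [h, h'])

@[simp]
lemma artin_self (k : ℕ) : artin k (of k) = (of k)⁻¹ * of (k + 1) * of k := by
  simp [artin]

@[simp]
lemma artin_succ (k : ℕ) : artin k (of (k + 1)) = of k := by
  simp [artin]

lemma artin_of_ne {k i : ℕ} (h : i ≠ k) (h' : i ≠ k + 1) : artin k (of i) = of i := by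
  simp [artin, h, h']

lemma isConj_artin_of (k i : ℕ) : IsConj (of (Equiv.swap k (k + 1) i)) (artin k (of i)) := by
  obtain rfl | h := eq_or_ne i k
  · exact isConj_iff.mpr ⟨(of i)⁻¹, by simp⟩
  obtain rfl | h' := eq_or_ne i (k + 1)
  · rw [Equiv.swap_apply_right, artin_succ]
  · rw [Equiv.swap_apply_of_ne_of_ne h h', artin_of_ne h h']

lemma mulAut_freeGroup_ext {α : Type*} {φ ψ : MulAut (FreeGroup α)}
    (h : ∀ i, φ (of i) = ψ (of i)) : φ = ψ :=
  MulEquiv.toMonoidHom_injective (FreeGroup.ext_hom _ _ h)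

lemma artin_commute {j k : ℕ} (h : j + 1 < k) : Commute (artin j) (artin k) := by
  refine mulAut_freeGroup_ext fun i => ?_
  have hj : artin k (of j) = of j := artin_of_ne (by omega) (by omega)
  have hj' : artin k (of (j + 1)) = of (j + 1) := artin_of_ne (by omega) (by omega)
  have hk : artin j (of k) = of k := artin_of_ne (by omega) (by omega)
  have hk' : artin j (of (k + 1)) = of (k + 1) := artin_of_ne (by omega) (by omega)
  obtain rfl | h1 := eq_or_ne i j
  · simp [hj, hj']
  obtain rfl | h2 := eq_or_ne i (j + 1)
  · simp [hj, hj']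
  obtain rfl | h3 := eq_or_ne i k
  · simp [hk, hk']
  obtain rfl | h4 := eq_or_ne i (k + 1)
  · simp [hk, hk']
  · simp [artin_of_ne h1 h2, artin_of_ne h3 h4]

lemma artin_braid (k : ℕ) :
    artin k * artin (k + 1) * artin k = artin (k + 1) * artin k * artin (k + 1) := by
  refine mulAut_freeGroup_ext fun i => ?_
  have hk : artin (k + 1) (of k) = of k := artin_of_ne (by omega) (by omega)
  have hk' : artin k (of (k + 1 + 1)) = of (k + 1 + 1) := artin_of_ne (by omega) (by omega)
  obtain rfl | h1 := eq_or_ne i k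
  · simp [hk, hk', mul_assoc]
  obtain rfl | h2 := eq_or_ne i (k + 1)
  · simp [hk, hk']
  obtain rfl | h3 := eq_or_ne i (k + 1 + 1)
  · simp [hk, hk']
  · simp [artin_of_ne h1 h2, artin_of_ne h2 h3]

/-- The action of the `k`-th braid generator on `ℕ × FreeGroup ℕ`. It is induced from the action of
the stabilizer of the last strand on the free group of loops of that strand, on which the loops act
by left multiplication and the braids of the other strands by Artin's automorphisms; the first
coordinate is the position of the strand, and the others are renumbered in order. -/
def strandPerm (k : ℕ) : Equiv.Perm (ℕ × FreeGroup ℕ) where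
  toFun p := if p.1 < k then (p.1, artin (k - 1) p.2) else if p.1 = k then (k + 1, of k * p.2)
    else if p.1 = k + 1 then (k, p.2) else (p.1, artin k p.2)
  invFun p := if p.1 < k then (p.1, (artin (k - 1)).symm p.2) else if p.1 = k then (k + 1, p.2)
    else if p.1 = k + 1 then (k, (of k)⁻¹ * p.2) else (p.1, (artin k).symm p.2)
  left_inv := by
    rintro ⟨i, f⟩
    obtain h | rfl | h := lt_trichotomy i k
    · simp [h]
    · simp
    obtain rfl | h' := eq_or_ne i (k + 1)
    · simp
    · simp [h.not_gt, h.ne', h']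
  right_inv := by
    rintro ⟨i, f⟩
    obtain h | rfl | h := lt_trichotomy i k
    · simp [h]
    · simp
    obtain rfl | h' := eq_or_ne i (k + 1)
    · simp
    · simp [h.not_gt, h.ne', h']

lemma strandPerm_of_le {i k : ℕ} (h : i ≤ k) (f : FreeGroup ℕ) :
    strandPerm (k + 1) (i, f) = (i, artin k f) := by
  rw [strandPerm, Equiv.coe_fn_mk, if_pos (Nat.lt_succ_of_le h), Nat.add_sub_cancel]

lemma strandPerm_self (k : ℕ) (f : FreeGroup ℕ) : strandPerm k (k, f) = (k + 1, of k * f) := by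
  simp [strandPerm]

lemma strandPerm_succ (k : ℕ) (f : FreeGroup ℕ) : strandPerm k (k + 1, f) = (k, f) := by
  simp [strandPerm]

lemma strandPerm_of_gt {i k : ℕ} (h : k + 1 < i) (f : FreeGroup ℕ) :
    strandPerm k (i, f) = (i, artin k f) := by
  have hk : ¬ i < k := by omega
  have hk' : i ≠ k := by omega
  simp [strandPerm, hk, hk', h.ne']

lemma strandPerm_commute {j k : ℕ} (h : j + 1 < k) : Commute (strandPerm j) (strandPerm k) := by
  have hartin : ∀ {a b : ℕ}, a + 1 < b → ∀ f, artin a (artin b f) = artin b (artin a f) :=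
    fun h => DFunLike.congr_fun (artin_commute h).eq
  obtain ⟨k, rfl⟩ : ∃ m, k = m + 1 := ⟨k - 1, by omega⟩
  refine Equiv.ext fun ⟨i, f⟩ => ?_
  simp only [Equiv.Perm.mul_apply]
  obtain hi | rfl | hi := lt_trichotomy i j
  · obtain ⟨j, rfl⟩ : ∃ m, j = m + 1 := ⟨j - 1, by omega⟩
    simp only [strandPerm_of_le (show i ≤ k by omega), strandPerm_of_le (show i ≤ j by omega),
      hartin (show j + 1 < k by omega)]
  · simp only [strandPerm_of_le (show i ≤ k by omega), strandPerm_of_le (show i + 1 ≤ k by omega),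
      strandPerm_self, map_mul, artin_of_ne (show i ≠ k by omega) (show i ≠ k + 1 by omega)]
  obtain rfl | hi' := eq_or_ne i (j + 1)
  · simp only [strandPerm_of_le (show j + 1 ≤ k by omega), strandPerm_of_le (show j ≤ k by omega),
      strandPerm_succ]
  have hji : j + 1 < i := by omega
  obtain hk | rfl | hk := lt_trichotomy i (k + 1)
  · simp only [strandPerm_of_le (show i ≤ k by omega), strandPerm_of_gt hji,
      hartin (show j + 1 < k by omega)]
  · simp only [strandPerm_of_gt hji, strandPerm_of_gt (show j + 1 < k + 1 + 1 by omega),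
      strandPerm_self, map_mul, artin_of_ne (show k + 1 ≠ j by omega) (show k + 1 ≠ j + 1 by omega)]
  obtain rfl | hk' := eq_or_ne i (k + 1 + 1)
  · simp only [strandPerm_of_gt hji, strandPerm_of_gt h, strandPerm_succ]
  · simp only [strandPerm_of_gt hji, strandPerm_of_gt (show k + 1 + 1 < i by omega), hartin h]

lemma strandPerm_braid (k : ℕ) :
    strandPerm k * strandPerm (k + 1) * strandPerm k =
      strandPerm (k + 1) * strandPerm k * strandPerm (k + 1) := by
  have hartin : ∀ k f, artin k (artin (k + 1) (artin k f)) =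
      artin (k + 1) (artin k (artin (k + 1) f)) := fun k => DFunLike.congr_fun (artin_braid k)
  have hgt : k + 1 < k + 1 + 1 := by omega
  refine Equiv.ext fun ⟨i, f⟩ => ?_
  simp only [Equiv.Perm.mul_apply]
  obtain hi | rfl | hi := lt_trichotomy i k
  · obtain ⟨k, rfl⟩ : ∃ m, k = m + 1 := ⟨k - 1, by omega⟩
    simp only [strandPerm_of_le (show i ≤ k by omega), strandPerm_of_le (show i ≤ k + 1 by omega),
      hartin]
  · simp only [strandPerm_self, strandPerm_of_le le_rfl, strandPerm_of_gt hgt, map_mul, artin_self,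
      artin_succ, mul_assoc, mul_inv_cancel_left]
  obtain rfl | hi' := eq_or_ne i (k + 1)
  · simp only [strandPerm_succ, strandPerm_self, strandPerm_of_le le_rfl, strandPerm_of_gt hgt,
      map_mul, artin_succ]
  obtain rfl | hi'' := eq_or_ne i (k + 1 + 1)
  · simp only [strandPerm_succ, strandPerm_of_le le_rfl, strandPerm_of_gt hgt]
  · simp only [strandPerm_of_gt (show k + 1 < i by omega),
      strandPerm_of_gt (show k + 1 + 1 < i by omega), hartin]

/-- The action of the braid group on `ℕ × FreeGroup ℕ` through the permutations `strandPerm k`. -/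
def strandAction (n : ℕ) : BraidGroup n →* Equiv.Perm (ℕ × FreeGroup ℕ) :=
  braidLift n strandPerm (fun _ _ => strandPerm_commute) strandPerm_braid

lemma strandAction_sigma {k : ℕ} (hk : k < n - 1) :
    strandAction n (sigma n k) = strandPerm k := braidLift_sigma _ _ hk

/-- The braid `σ_i σ_{i+1} ⋯ σ_{n-2}`, which carries the last strand to the position `i`. -/
def strandRep (n i : ℕ) : BraidGroup n := ((List.range' i (n - 1 - i)).map (sigma n)).prod

lemma strandRep_of_le {i : ℕ} (h : n - 1 ≤ i) : strandRep n i = 1 := by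
  rw [strandRep, Nat.sub_eq_zero_of_le h]
  rfl

lemma strandRep_eq_sigma_mul (i : ℕ) : strandRep n i = sigma n i * strandRep n (i + 1) := by
  obtain h | h := lt_or_ge i (n - 1)
  · have hlen : n - 1 - i = (n - 1 - (i + 1)) + 1 := by omega
    rw [strandRep, hlen, List.range'_succ, List.map_cons, List.prod_cons, strandRep]
  · rw [strandRep_of_le h, strandRep_of_le (h.trans i.le_succ), sigma_of_le h, one_mul]

lemma sigma_commute_strandRep {k i : ℕ} (h : k + 1 < i) :
    Commute (sigma n k) (strandRep n i) := by
  refine Commute.list_prod_right _ _ fun x hx => ?_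
  obtain ⟨j, hj, rfl⟩ := List.mem_map.mp hx
  rw [List.mem_range'_1] at hj
  exact sigma_commute (by omega)

lemma sigma_succ_mul_strandRep {k i : ℕ} (hik : i ≤ k) (hk : k + 1 < n - 1) :
    sigma n (k + 1) * strandRep n i = strandRep n i * sigma n k := by
  induction hik using Nat.decreasingInduction with
  | self =>
    have hcomm := (sigma_commute_strandRep (n := n) (show k + 1 < k + 1 + 1 by omega)).eq
    rw [strandRep_eq_sigma_mul k, strandRep_eq_sigma_mul (k + 1)]
    calc sigma n (k + 1) * (sigma n k * (sigma n (k + 1) * strandRep n (k + 1 + 1)))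
        = sigma n (k + 1) * sigma n k * sigma n (k + 1) * strandRep n (k + 1 + 1) := by
          simp only [mul_assoc]
      _ = sigma n k * sigma n (k + 1) * (sigma n k * strandRep n (k + 1 + 1)) := by
          rw [← sigma_braid hk, mul_assoc]
      _ = sigma n k * (sigma n (k + 1) * strandRep n (k + 1 + 1)) * sigma n k := by
          rw [hcomm]
          simp only [mul_assoc]
  | of_succ i hi ih =>
    have hcomm := (sigma_commute (n := n) (show i + 1 < k + 1 by omega)).eq
    rw [strandRep_eq_sigma_mul i, ← mul_assoc, ← hcomm, mul_assoc, ih, mul_assoc]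

lemma braidPerm_strandRep_last {i : ℕ} (hi : i ≤ n - 1) :
    braidPerm n (strandRep n i) (n - 1) = i := by
  induction hi using Nat.decreasingInduction with
  | self => rw [strandRep_of_le le_rfl, map_one, Equiv.Perm.one_apply]
  | of_succ i hi ih =>
    rw [strandRep_eq_sigma_mul, map_mul, Equiv.Perm.mul_apply, ih, braidPerm_sigma hi,
      Equiv.swap_apply_right]

lemma braidPerm_strandRep_of_lt {i j : ℕ} (hi : i ≤ n - 1) (hj : j < i) :
    braidPerm n (strandRep n i) j = j := by
  induction hi using Nat.decreasingInduction with
  | self => rw [strandRep_of_le le_rfl, map_one, Equiv.Perm.one_apply]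
  | of_succ i hi ih =>
    rw [strandRep_eq_sigma_mul, map_mul, Equiv.Perm.mul_apply, ih (by omega), braidPerm_sigma hi,
      Equiv.swap_apply_of_ne_of_ne (by omega) (by omega)]

lemma strandAction_strandRep {i : ℕ} (hi : i ≤ n - 1) (f : FreeGroup ℕ) :
    strandAction n (strandRep n i) (n - 1, f) = (i, f) := by
  induction hi using Nat.decreasingInduction with
  | self => rw [strandRep_of_le le_rfl, map_one, Equiv.Perm.one_apply]
  | of_succ i hi ih =>
    rw [strandRep_eq_sigma_mul, map_mul, Equiv.Perm.mul_apply, ih, strandAction_sigma hi,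
      strandPerm_succ]

/-- The pure braid in which the last strand turns once around the strand `i`. -/
def strandLoop (n i : ℕ) : BraidGroup n :=
  (strandRep n (i + 1))⁻¹ * sigma n i ^ 2 * strandRep n (i + 1)

lemma strandLoop_of_le {i : ℕ} (h : n - 1 ≤ i) : strandLoop n i = 1 := by
  simp [strandLoop, sigma_of_le h]

lemma strandLoop_last (h : 2 ≤ n) : strandLoop n (n - 2) = sigma n (n - 2) ^ 2 := by
  rw [strandLoop, strandRep_of_le (by omega), inv_one, one_mul, mul_one]

lemma conj_sq_of_braid {G : Type*} [Group G] {a b : G} (h : a * b * a = b * a * b) :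
    a * b ^ 2 * a⁻¹ = b⁻¹ * a ^ 2 * b := by
  have hconj : a * b * a⁻¹ = b⁻¹ * a * b := by
    rw [mul_inv_eq_iff_eq_mul, mul_assoc b⁻¹, mul_assoc b⁻¹, eq_inv_mul_iff_mul_eq, ← mul_assoc, h]
  rw [← conj_pow, hconj, ← inv_inv b, inv_inv b⁻¹]
  simpa using conj_pow (i := 2) (a := b⁻¹) (b := a)

lemma conj_conj_sq_of_braid {G : Type*} [Group G] {a b : G} (h : a * b * a = b * a * b) :
    a * (b⁻¹ * a ^ 2 * b) * a⁻¹ = (b⁻¹ * a ^ 2 * b)⁻¹ * b ^ 2 * (b⁻¹ * a ^ 2 * b) := by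
  -- `a ^ 2 * b * a ^ 2 * b` is the full twist on three strands, the central element `(a * b) ^ 3`.
  have hcomm : (a * a * b * a * a) * b = b * (a * a * b * a * a) := by
    calc (a * a * b * a * a) * b = a * (a * b * a) * (a * b) := by simp only [mul_assoc]
      _ = a * (b * a * b) * (a * b) := by rw [h]
      _ = (a * b * a) * (b * a * b) := by simp only [mul_assoc]
      _ = (b * a * b) * (a * b * a) := by rw [h]
      _ = b * a * (b * a * b) * a := by simp only [mul_assoc]
      _ = b * (a * a * b * a * a) := by rw [← h]; simp only [mul_assoc]
  have hcomm_sq : (a * a * b * a * a) * b ^ 2 = b ^ 2 * (a * a * b * a * a) :=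
    ((show Commute _ _ from hcomm).pow_right 2).eq
  calc a * (b⁻¹ * a ^ 2 * b) * a⁻¹ = a * (a * b ^ 2 * a⁻¹) * a⁻¹ := by rw [conj_sq_of_braid h]
    _ = b⁻¹ * (a ^ 2)⁻¹ * ((a * a * b * a * a) * b ^ 2) * (a ^ 2)⁻¹ := by simp only [sq]; group
    _ = _ := by rw [hcomm_sq]; simp only [sq]; group

lemma sigma_conj_strandLoop_of_lt {i k : ℕ} (hik : i < k) (hk : k + 1 < n - 1) :
    sigma n k * strandLoop n i * (sigma n k)⁻¹ = strandLoop n i := by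
  have hrep := sigma_succ_mul_strandRep (n := n) (i := i + 1) hik hk
  have hcomm : sigma n (k + 1) * sigma n i ^ 2 * (sigma n (k + 1))⁻¹ = sigma n i ^ 2 :=
    mul_inv_eq_iff_eq_mul.mpr ((sigma_commute (by omega)).symm.pow_right 2).eq
  have hsigma : sigma n k = (strandRep n (i + 1))⁻¹ * sigma n (k + 1) * strandRep n (i + 1) := by
    rw [mul_assoc, hrep, inv_mul_cancel_left]
  calc sigma n k * strandLoop n i * (sigma n k)⁻¹
      = (strandRep n (i + 1))⁻¹ * (sigma n (k + 1) * sigma n i ^ 2 * (sigma n (k + 1))⁻¹) *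
          strandRep n (i + 1) := by rw [hsigma, strandLoop]; group
    _ = strandLoop n i := by rw [hcomm, strandLoop]

lemma sigma_conj_strandLoop_of_gt {i k : ℕ} (hik : k + 1 < i) :
    sigma n k * strandLoop n i * (sigma n k)⁻¹ = strandLoop n i := by
  have hrep : Commute (sigma n k) (strandRep n (i + 1)) := sigma_commute_strandRep (by omega)
  have hsq : Commute (sigma n k) (sigma n i ^ 2) := (sigma_commute hik).pow_right 2
  exact mul_inv_eq_iff_eq_mul.mpr ((hrep.inv_right.mul_right hsq).mul_right hrep).eq

lemma strandRep_conj_sigma_conj (k : ℕ) (x : BraidGroup n) :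
    sigma n k * ((strandRep n (k + 2))⁻¹ * x * strandRep n (k + 2)) * (sigma n k)⁻¹ =
      (strandRep n (k + 2))⁻¹ * (sigma n k * x * (sigma n k)⁻¹) * strandRep n (k + 2) := by
  have hcomm : Commute (sigma n k) (strandRep n (k + 2)) := sigma_commute_strandRep (by omega)
  simp only [mul_assoc, hcomm.inv_left.eq, ← hcomm.inv_right.left_comm]

lemma strandLoop_eq_strandRep_conj (k : ℕ) :
    strandLoop n k = (strandRep n (k + 2))⁻¹ *
      ((sigma n (k + 1))⁻¹ * sigma n k ^ 2 * sigma n (k + 1)) * strandRep n (k + 2) := by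
  rw [strandLoop, strandRep_eq_sigma_mul (k + 1)]
  group

lemma sigma_conj_strandLoop_succ {k : ℕ} (hk : k + 1 < n - 1) :
    sigma n k * strandLoop n (k + 1) * (sigma n k)⁻¹ = strandLoop n k := by
  rw [strandLoop, strandRep_conj_sigma_conj, conj_sq_of_braid (sigma_braid hk),
    ← strandLoop_eq_strandRep_conj]

lemma sigma_conj_strandLoop_self {k : ℕ} (hk : k + 1 < n - 1) :
    sigma n k * strandLoop n k * (sigma n k)⁻¹ =
      (strandLoop n k)⁻¹ * strandLoop n (k + 1) * strandLoop n k := by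
  rw [strandLoop_eq_strandRep_conj, strandRep_conj_sigma_conj,
    conj_conj_sq_of_braid (sigma_braid hk), strandLoop]
  group

/-- The homomorphism from the free group onto the braids in which only the last strand moves. -/
def loopHom (n : ℕ) : FreeGroup ℕ →* BraidGroup n := FreeGroup.lift (strandLoop n)

@[simp]
lemma loopHom_of (i : ℕ) : loopHom n (of i) = strandLoop n i := FreeGroup.lift_apply_of

lemma sigma_conj_loopHom {k : ℕ} (hk : k + 1 < n - 1) (w : FreeGroup ℕ) :
    sigma n k * loopHom n w * (sigma n k)⁻¹ = loopHom n (artin k w) := by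
  suffices h : (MulAut.conj (sigma n k)).toMonoidHom.comp (loopHom n) =
      (loopHom n).comp (artin k).toMonoidHom from DFunLike.congr_fun h w
  refine FreeGroup.ext_hom _ _ fun i => ?_
  change sigma n k * loopHom n (of i) * (sigma n k)⁻¹ = loopHom n (artin k (of i))
  obtain hi | rfl | hi := lt_trichotomy i k
  · simp only [artin_of_ne hi.ne (show i ≠ k + 1 by omega), loopHom_of,
      sigma_conj_strandLoop_of_lt hi hk]
  · simp only [artin_self, map_mul, map_inv, loopHom_of, sigma_conj_strandLoop_self hk]
  obtain rfl | hi' := eq_or_ne i (k + 1)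
  · simp only [artin_succ, loopHom_of, sigma_conj_strandLoop_succ hk]
  · simp only [artin_of_ne hi.ne' hi', loopHom_of,
      sigma_conj_strandLoop_of_gt (show k + 1 < i by omega)]

/-- The endomorphism of the free group that kills the generators with index at least `m`. -/
def truncate (m : ℕ) : FreeGroup ℕ →* FreeGroup ℕ :=
  FreeGroup.lift fun i => if i < m then of i else 1

lemma truncate_of_lt {m i : ℕ} (h : i < m) : truncate m (of i) = of i := by
  simp [truncate, h]

lemma truncate_of_le {m i : ℕ} (h : m ≤ i) : truncate m (of i) = 1 := by
  simp [truncate, h.not_gt]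

lemma loopHom_truncate (w : FreeGroup ℕ) : loopHom n (truncate (n - 1) w) = loopHom n w := by
  suffices h : (loopHom n).comp (truncate (n - 1)) = loopHom n from DFunLike.congr_fun h w
  ext i
  obtain h | h := lt_or_ge i (n - 1)
  · simp [truncate_of_lt h]
  · simp [truncate_of_le h, strandLoop_of_le h]

lemma strandAction_strandLoop {i : ℕ} (hi : i < n - 1) (f : FreeGroup ℕ) :
    strandAction n (strandLoop n i) (n - 1, f) = (n - 1, of i * f) := by
  rw [strandLoop, map_mul, map_mul, Equiv.Perm.mul_apply, Equiv.Perm.mul_apply,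
    strandAction_strandRep hi, sq, map_mul, Equiv.Perm.mul_apply, strandAction_sigma hi,
    strandPerm_succ, strandPerm_self, map_inv, Equiv.Perm.inv_eq_iff_eq, strandAction_strandRep hi]

lemma strandAction_loopHom (w f : FreeGroup ℕ) :
    strandAction n (loopHom n w) (n - 1, f) = (n - 1, truncate (n - 1) w * f) := by
  induction w using FreeGroup.induction_on generalizing f with
  | C1 => simp
  | of i =>
    obtain h | h := lt_or_ge i (n - 1)
    · rw [loopHom_of, strandAction_strandLoop h, truncate_of_lt h]
    · simp [truncate_of_le h, strandLoop_of_le h]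
  | inv_of i ih =>
    rw [map_inv, map_inv, Equiv.Perm.inv_eq_iff_eq, ih, map_inv, mul_inv_cancel_left]
  | mul x y hx hy => rw [map_mul, map_mul, Equiv.Perm.mul_apply, hy, hx, map_mul, mul_assoc]

lemma braidPerm_strandLoop {i : ℕ} (hi : i < n - 1) : braidPerm n (strandLoop n i) = 1 := by
  simp [strandLoop, braidPerm_sigma hi, sq]

/-- The braids that act by conjugation on the loops of the last strand, through an automorphism of
the free group that permutes the generators up to conjugacy in the same way as the strands. -/
def loopNormalizing (n : ℕ) : Subgroup (BraidGroup n) where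
  carrier := {d | ∃ φ : MulAut (FreeGroup ℕ), (∀ w, d * loopHom n w * d⁻¹ = loopHom n (φ w)) ∧
    ∀ i, IsConj (of (braidPerm n d i)) (φ (of i))}
  one_mem' := ⟨1, by simp, fun _ => IsConj.refl _⟩
  mul_mem' := by
    rintro d e ⟨φ, hφ, hφ'⟩ ⟨ψ, hψ, hψ'⟩
    refine ⟨φ * ψ, fun w => ?_, fun i => ?_⟩
    · rw [MulAut.mul_apply, ← hφ, ← hψ]
      group
    · rw [map_mul, Equiv.Perm.mul_apply, MulAut.mul_apply]
      exact (hφ' _).trans (φ.toMonoidHom.map_isConj (hψ' i))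
  inv_mem' := by
    rintro d ⟨φ, hφ, hφ'⟩
    refine ⟨φ⁻¹, fun w => ?_, fun i => ?_⟩
    · have hw := hφ (φ⁻¹ w)
      rw [MulAut.apply_inv_self] at hw
      rw [← hw]
      group
    · have hi := (φ⁻¹.toMonoidHom.map_isConj (hφ' (braidPerm n d⁻¹ i))).symm
      change IsConj (φ⁻¹ (φ _)) _ at hi
      rwa [MulAut.inv_apply_self, ← Equiv.Perm.mul_apply, ← map_mul, mul_inv_cancel, map_one,
        Equiv.Perm.one_apply] at hi

lemma sigma_mem_loopNormalizing {k : ℕ} (hk : k + 1 < n - 1) : sigma n k ∈ loopNormalizing n :=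
  ⟨artin k, sigma_conj_loopHom hk, fun i => by
    rw [braidPerm_sigma (by omega)]
    exact isConj_artin_of k i⟩

lemma strandLoop_mem_loopNormalizing {i : ℕ} (hi : i < n - 1) :
    strandLoop n i ∈ loopNormalizing n := by
  refine ⟨MulAut.conj (of i), fun w => ?_, fun j => ?_⟩
  · simp
  · rw [braidPerm_strandLoop hi]
    exact isConj_iff.mpr ⟨of i, rfl⟩

lemma sigma_transfer_mem_loopNormalizing {k : ℕ} (hk : k < n - 1) {j : ℕ} (hj : j ≤ n - 1) :
    (strandRep n (Equiv.swap k (k + 1) j))⁻¹ * sigma n k * strandRep n j ∈ loopNormalizing n := by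
  obtain h | rfl | h := lt_trichotomy j k
  · obtain ⟨k, rfl⟩ : ∃ m, k = m + 1 := ⟨k - 1, by omega⟩
    rw [Equiv.swap_apply_of_ne_of_ne (by omega) (by omega), mul_assoc,
      sigma_succ_mul_strandRep (by omega) hk, inv_mul_cancel_left]
    exact sigma_mem_loopNormalizing hk
  · have hloop : (strandRep n (j + 1))⁻¹ * sigma n j * strandRep n j = strandLoop n j := by
      rw [strandLoop, strandRep_eq_sigma_mul j, sq]
      group
    rw [Equiv.swap_apply_left, hloop]
    exact strandLoop_mem_loopNormalizing hk
  obtain rfl | h' := eq_or_ne j (k + 1)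
  · rw [Equiv.swap_apply_right, mul_assoc, ← strandRep_eq_sigma_mul, inv_mul_cancel]
    exact one_mem _
  · have hcomm : Commute (sigma n k) (strandRep n j) := sigma_commute_strandRep (by omega)
    rw [Equiv.swap_apply_of_ne_of_ne h.ne' h', mul_assoc, hcomm.eq, inv_mul_cancel_left]
    exact sigma_mem_loopNormalizing (by omega)

theorem transfer_mem_loopNormalizing (g : BraidGroup n) {j : ℕ} (hj : j ≤ n - 1) :
    (strandRep n (braidPerm n g j))⁻¹ * g * strandRep n j ∈ loopNormalizing n := by
  induction g using braid_induction generalizing j with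
  | sigma k hk =>
    rw [braidPerm_sigma hk]
    exact sigma_transfer_mem_loopNormalizing hk hj
  | one => simp
  | mul g h hg hh =>
    have hmem := mul_mem (hg ((braidPerm_le_iff h).mpr hj)) (hh hj)
    rw [← Equiv.Perm.mul_apply, ← map_mul] at hmem
    convert hmem using 1
    group
  | inv g hg =>
    have hmem := inv_mem (hg ((braidPerm_le_iff g⁻¹).mpr hj))
    rw [← Equiv.Perm.mul_apply, ← map_mul, mul_inv_cancel, map_one, Equiv.Perm.one_apply] at hmem
    convert hmem using 1
    group

variable {R : Type*} [Ring R]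

lemma splitPair_loopHom {i j : ℕ} (hi : i < n - 1) (hj : j < n - 1) (f : FreeGroup ℕ) :
    SplitPair R (loopHom n (of i)) (loopHom n (f * of j * f⁻¹)) := by
  have hsemi : ∀ w, Function.Semiconj (fun x : FreeGroup ℕ => (n - 1, x))
      (Equiv.mulLeft (truncate (n - 1) w)) (strandAction n (loopHom n w)) := fun w x =>
    (strandAction_loopHom w x).symm
  obtain h | ⟨ℓ, hℓ⟩ := of_eq_conj_or_exists_isPingPongLength i j (truncate (n - 1) f)
  · left
    have hw : truncate (n - 1) (f * of j * f⁻¹) = of i := by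
      rw [map_mul, map_mul, map_inv, truncate_of_lt hj, ← h]
    rw [← loopHom_truncate (f * of j * f⁻¹), hw]
  · refine .inr (.inl (noCommonMultiple_subOne_of_pingPong (strandAction n)
      (Prod.mk_right_injective (n - 1)) (hsemi _) (hsemi _) (ℓ := ℓ) ?_))
    rwa [map_mul, map_mul, map_inv, truncate_of_lt hi, truncate_of_lt hj]

/-- The change of basis of the free group that turns the square of Artin's automorphism `artin 0`
into the conjugation of one generator by another. -/
def twistBasis : MulAut (FreeGroup ℕ) :=
  MonoidHom.toMulEquiv
    (FreeGroup.lift fun i => if i = 1 then of 1 * (of 0)⁻¹ else of i)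
    (FreeGroup.lift fun i => if i = 1 then of 1 * of 0 else of i)
    (by
      ext i
      obtain rfl | h := eq_or_ne i 1
      · simp
      · simp [h])
    (by
      ext i
      obtain rfl | h := eq_or_ne i 1
      · simp
      · simp [h])

lemma twistBasis_of_one : twistBasis (of 1) = of 1 * (of 0)⁻¹ := by
  simp [twistBasis]

lemma twistBasis_of_ne {i : ℕ} (h : i ≠ 1) : twistBasis (of i) = of i := by
  simp [twistBasis, h]

lemma twistBasis_mul_artin_sq :
    twistBasis * artin 0 ^ 2 = twist 0 ⟨of 1, of_mem_avoiding one_ne_zero⟩ * twistBasis := by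
  refine mulAut_freeGroup_ext fun i => ?_
  have hself := artin_self 0
  have hsucc := artin_succ 0
  rw [zero_add] at hself hsucc
  simp only [sq, MulAut.mul_apply]
  obtain rfl | h1 := eq_or_ne i 1
  · simp [hself, hsucc, twistBasis_of_one, twistBasis_of_ne, twist_self, twist_of_ne, mul_assoc]
  obtain rfl | h0 := eq_or_ne i 0
  · simp [hself, hsucc, twistBasis_of_one, twistBasis_of_ne, twist_self, mul_assoc]
  · simp [artin_of_ne h0 h1, twistBasis_of_ne h1, twist_of_ne h0]

lemma twistBasis_symm_twist (x : FreeGroup ℕ) :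
    twistBasis.symm (twist 0 ⟨of 1, of_mem_avoiding one_ne_zero⟩ x) =
      (artin 0 ^ 2) (twistBasis.symm x) := by
  have h := DFunLike.congr_fun twistBasis_mul_artin_sq (twistBasis.symm x)
  rw [MulAut.mul_apply, MulAut.mul_apply, MulEquiv.apply_symm_apply] at h
  rw [← h, MulEquiv.symm_apply_apply]

lemma strandAction_sigma_zero (hn : 1 < n - 1) (x : FreeGroup ℕ) :
    strandAction n (sigma n 0) (n - 1, x) = (n - 1, artin 0 x) := by
  rw [strandAction_sigma (by omega), strandPerm_of_gt (by omega)]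

lemma noCommonMultiple_sigma_zero_sq_loopHom {j : ℕ} (hj : 2 ≤ j) (hjn : j < n - 1)
    {f : FreeGroup ℕ} (hf : twistBasis (truncate (n - 1) f) ∉ avoiding 0) :
    NoCommonMultiple (subOne R (sigma n 0 ^ 2)) (subOne R (loopHom n (f * of j * f⁻¹))) := by
  have hn : 1 < n - 1 := by omega
  refine noCommonMultiple_subOne_of_pingPong (strandAction n)
    (ι := fun x => (n - 1, twistBasis.symm x))
    ((Prod.mk_right_injective (n - 1)).comp twistBasis.symm.injective) (fun x => ?_) (fun x => ?_)
    (isPingPongLength_twist (p := ⟨of j, of_mem_avoiding (by omega)⟩)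
      (q := ⟨of 1, of_mem_avoiding one_ne_zero⟩) ?_ ?_ hf)
  · change (n - 1, twistBasis.symm (twist 0 _ x)) = _
    rw [twistBasis_symm_twist, sq, sq, map_mul, Equiv.Perm.mul_apply, strandAction_sigma_zero hn,
      strandAction_sigma_zero hn, MulAut.mul_apply]
  · have hof : twistBasis.symm (of j) = of j :=
      (MulEquiv.symm_apply_eq _).mpr (twistBasis_of_ne (by omega)).symm
    rw [strandAction_loopHom, Equiv.coe_mulLeft]
    simp only [map_mul, map_inv, MulEquiv.symm_apply_apply, hof, truncate_of_lt hjn]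
  all_goals exact fun h => FreeGroup.of_ne_one _ (congrArg Subtype.val h)

lemma commute_sigma_zero_sq_loopHom (hn : 1 < n - 1) {w : FreeGroup ℕ}
    (hw : twistBasis w ∈ avoiding 0) : Commute (sigma n 0 ^ 2) (loopHom n w) := by
  have hfix : artin 0 (artin 0 w) = w := by
    have h := twistBasis_symm_twist (twistBasis w)
    rw [twist_of_mem_avoiding _ hw, MulEquiv.symm_apply_apply, sq, MulAut.mul_apply] at h
    exact h.symm
  refine mul_inv_eq_iff_eq_mul.mp ?_
  calc sigma n 0 ^ 2 * loopHom n w * (sigma n 0 ^ 2)⁻¹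
      = sigma n 0 * (sigma n 0 * loopHom n w * (sigma n 0)⁻¹) * (sigma n 0)⁻¹ := by
        simp only [sq, mul_inv_rev, mul_assoc]
    _ = loopHom n w := by rw [sigma_conj_loopHom hn, sigma_conj_loopHom hn, hfix]

lemma sigma_mem_conjSquares {k : ℕ} (hk : k < n - 1) : sigma n k ^ 2 ∈ conjSquares n :=
  ⟨1, ⟨k, hk⟩, by rw [sigma_of_lt hk, one_mul, inv_one, mul_one]⟩

lemma eq_zero_of_sigma_zero_sq_zpow_eq (hn : 1 < n - 1) {w : FreeGroup ℕ}
    (hw : truncate (n - 1) w ≠ 1) {a b : ℤ} (h : (sigma n 0 ^ 2) ^ a = loopHom n w ^ b) :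
    a = 0 := by
  have hfix : strandAction n (sigma n 0 ^ 2) (n - 1, 1) = (n - 1, 1) := by
    rw [sq, map_mul, Equiv.Perm.mul_apply, strandAction_sigma_zero hn, map_one,
      strandAction_sigma_zero hn, map_one]
  have hloop : strandAction n ((sigma n 0 ^ 2) ^ a) (n - 1, 1) =
      (n - 1, truncate (n - 1) w ^ b) := by
    rw [h, ← map_zpow, strandAction_loopHom, mul_one, map_zpow]
  rw [map_zpow, Equiv.Perm.zpow_apply_eq_self_of_apply_eq_self hfix, Prod.mk.injEq] at hloop
  obtain rfl : b = 0 := (IsMulTorsionFree.zpow_eq_one_iff_right hw).mp hloop.2.symm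
  rw [zpow_zero] at h
  by_contra ha
  exact not_isOfFinOrder_of_mem_conjSquares (sigma_mem_conjSquares (by omega))
    (isOfFinOrder_iff_zpow_eq_one.mpr ⟨a, ha, h⟩)

lemma splitPair_sigma_zero_sq_loopHom {j : ℕ} (hj : 2 ≤ j) (hjn : j < n - 1) (f : FreeGroup ℕ) :
    SplitPair R (sigma n 0 ^ 2) (loopHom n (f * of j * f⁻¹)) := by
  have hn : 1 < n - 1 := by omega
  by_cases hf : twistBasis (truncate (n - 1) f) ∈ avoiding 0
  swap
  · exact .inr (.inl (noCommonMultiple_sigma_zero_sq_loopHom hj hjn hf))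
  refine .inr (.inr ⟨?_, fun a b => eq_zero_of_sigma_zero_sq_zpow_eq hn ?_⟩)
  · rw [← loopHom_truncate]
    refine commute_sigma_zero_sq_loopHom hn ?_
    simp only [map_mul, map_inv, truncate_of_lt hjn, twistBasis_of_ne (show j ≠ 1 by omega)]
    exact mul_mem (mul_mem hf (of_mem_avoiding (by omega))) (inv_mem hf)
  · rw [map_mul, map_mul, map_inv, truncate_of_lt hjn, Ne, conj_eq_one_iff]
    exact FreeGroup.of_ne_one j

lemma exists_strandRep_conj_eq_loopHom (hn : 2 ≤ n) (d : BraidGroup n) :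
    ∃ f j, j < n - 1 ∧
      braidPerm n (strandRep n (braidPerm n d (n - 1))) j = braidPerm n d (n - 2) ∧
      (strandRep n (braidPerm n d (n - 1)))⁻¹ * (d * sigma n (n - 2) ^ 2 * d⁻¹) *
        strandRep n (braidPerm n d (n - 1)) = loopHom n (f * of j * f⁻¹) := by
  have hmem := transfer_mem_loopNormalizing d le_rfl
  have hle : braidPerm n d (n - 1) ≤ n - 1 := (braidPerm_le_iff d).mpr le_rfl
  have hlast := braidPerm_strandRep_last hle
  rw [strandRep_of_le le_rfl, mul_one] at hmem
  obtain ⟨φ, hφ, hconj⟩ := hmem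
  obtain ⟨f, hf⟩ := isConj_iff.mp (hconj (n - 2))
  set r := strandRep n (braidPerm n d (n - 1))
  have hj : braidPerm n r (braidPerm n (r⁻¹ * d) (n - 2)) = braidPerm n d (n - 2) := by
    rw [← Equiv.Perm.mul_apply, ← map_mul, mul_inv_cancel_left]
  refine ⟨f, braidPerm n (r⁻¹ * d) (n - 2), ?_, hj, ?_⟩
  · refine ((braidPerm_le_iff _).mpr (by omega)).lt_of_ne fun h => ?_
    rw [h, hlast] at hj
    have := (braidPerm n d).injective hj
    omega
  · rw [hf, ← hφ, loopHom_of, strandLoop_last hn]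
    group

lemma strandRep_conj_sigma_zero_sq {q : ℕ} (hq : q ≤ 1) :
    (strandRep n q)⁻¹ * sigma n 0 ^ 2 * strandRep n q = strandLoop n 0 := by
  interval_cases q
  · rw [strandLoop, strandRep_eq_sigma_mul 0]
    group
  · rw [strandLoop]

lemma splitPair_of_braidPerm_last_le_one (hn : 2 ≤ n) {d : BraidGroup n}
    (hd : braidPerm n d (n - 1) ≤ 1) :
    SplitPair R (sigma n 0 ^ 2) (d * sigma n (n - 2) ^ 2 * d⁻¹) := by
  obtain ⟨f, j, hj, -, heq⟩ := exists_strandRep_conj_eq_loopHom hn d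
  refine .of_conj (strandRep n (braidPerm n d (n - 1))) ?_
  rw [heq, strandRep_conj_sigma_zero_sq hd, ← loopHom_of]
  exact splitPair_loopHom (by omega) hj f

lemma splitPair_of_two_le_braidPerm (hn : 2 ≤ n) {d : BraidGroup n}
    (hd : 2 ≤ braidPerm n d (n - 1)) (hd' : 2 ≤ braidPerm n d (n - 2)) :
    SplitPair R (sigma n 0 ^ 2) (d * sigma n (n - 2) ^ 2 * d⁻¹) := by
  obtain ⟨f, j, hj, hperm, heq⟩ := exists_strandRep_conj_eq_loopHom hn d
  have hcomm : Commute (sigma n 0 ^ 2) (strandRep n (braidPerm n d (n - 1))) :=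
    (sigma_commute_strandRep hd).pow_left 2
  refine .of_conj (strandRep n (braidPerm n d (n - 1))) ?_
  rw [heq, mul_assoc, hcomm.eq, inv_mul_cancel_left]
  refine splitPair_sigma_zero_sq_loopHom ?_ hj f
  by_contra! hj2
  rw [braidPerm_strandRep_of_lt ((braidPerm_le_iff d).mpr le_rfl) (hj2.trans_le hd)] at hperm
  omega

lemma splitPair_sigma_zero_sq_conj (hn : 2 ≤ n) (d : BraidGroup n) :
    SplitPair R (sigma n 0 ^ 2) (d * sigma n (n - 2) ^ 2 * d⁻¹) := by
  obtain hlast | hlast := le_or_gt (braidPerm n d (n - 1)) 1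
  · exact splitPair_of_braidPerm_last_le_one hn hlast
  obtain hprev | hprev := le_or_gt (braidPerm n d (n - 2)) 1
  · -- Multiplying `d` by `σ_{n-2}` exchanges the two strands and preserves the conjugate.
    have hconj : d * sigma n (n - 2) ^ 2 * d⁻¹ =
        (d * sigma n (n - 2)) * sigma n (n - 2) ^ 2 * (d * sigma n (n - 2))⁻¹ := by group
    have hswap : Equiv.swap (n - 2) (n - 2 + 1) (n - 1) = n - 2 := by
      rw [Equiv.swap_apply_eq_iff, Equiv.swap_apply_left]
      omega
    rw [hconj]
    refine splitPair_of_braidPerm_last_le_one hn ?_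
    rwa [map_mul, Equiv.Perm.mul_apply, braidPerm_sigma (by omega), hswap]
  · exact splitPair_of_two_le_braidPerm hn hlast hprev

theorem splitPair_of_mem_conjSquares {u v : BraidGroup n} (hu : u ∈ conjSquares n)
    (hv : v ∈ conjSquares n) : SplitPair R u v := by
  have hn : 2 ≤ n := by
    obtain ⟨-, i, -⟩ := hu
    have := i.2
    omega
  obtain ⟨c, rfl⟩ := isConj_iff.mp (isConj_sq_of_mem_conjSquares hu (show 0 < n - 1 by omega))
  obtain ⟨d, rfl⟩ := isConj_iff.mp (isConj_sq_of_mem_conjSquares hv (show n - 2 < n - 1 by omega))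
  refine .of_conj c ?_
  convert splitPair_sigma_zero_sq_conj hn (c⁻¹ * d) using 1 <;> group

end BraidGroup

theorem theorem1p3_general (R : Type*) [Ring R] [Nontrivial R] (n : ℕ) :
    Function.Injective (subOneHom R (commGraph n) Subtype.val fun _ _ h => h.2) :=
  subOneHom_injective Subtype.val_injective
    (fun _ _ => Iff.rfl) (fun u => not_isOfFinOrder_of_mem_conjSquares u.2)
    fun u v => splitPair_of_mem_conjSquares u.2 v.2

theorem theorem1p3 (n : ℕ) : Function.Injective (nuHom n) :=
  theorem1p3_general ℤ n
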